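/- Let $M,N\ge 1$, let $P_x,P_s,P_w>0$, and let $\mathbf H$ be a random $N\times M$ complex matrix. All logarithms are in base 2, expectations of matrices are entrywise, and $x^+=\max\{x,0\}$. Put $\rho=\frac{P_x}{M P_w}$ and define the dirt-free capacity and the lattice coding rate $$C=\mathbb E\big[\log\det(\mathbf I_M+\rho\,\mathbf H^H\mathbf H)\big],\qquad R=\Big(-\log\det\mathbb E\Big[\Big(\tfrac{P_x}{P_x+MP_s}\mathbf I_M+\rho\,\mathbf H^H\mathbf H\Big)^{-1}\Big]\Big)^+,$$ and the gap $\Delta=C-R$. In each of the following cases $C$ is finite, the expectation in $R$ exists and is a positive definite matrix, and, for all $P_s>0$: (i) If $N\ge M$, $\rho\ge 1$, $\mathbb E[\mathbf H^H\mathbf H]$ is finite, and $\mathbf H^H\mathbf H$ is almost surely invertible with all entries of $\mathbb E[(\mathbf H^H\mathbf H)^{-1}]$ finite, then $$\Delta<\log\det\Big(\big(\mathbf I_M+\mathbb E[\mathbf H^H\mathbf H]\big)\,\mathbb E\big[(\mathbf H^H\mathbf H)^{-1}\big]\Big).$$ (ii) If $N>M$, $\rho\ge 1$, and the entries of $\mathbf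 H$ are i.i.d. circularly symmetric complex Gaussian with zero mean and unit variance, then $$\Delta<M\log\Big(1+\frac{M+1}{N-M}\Big).$$ (iii) If $N=M=1$ and $\mathbf H=h$ with $\mathbb E[|h|^2]=1$, then for every $\rho>0$: if $|h|$ has a Nakagami-$m$ distribution with real $m>1$, $$\Delta<1+\log\Big(1+\frac1{m-1}\Big);$$ if $|h|$ has a Rayleigh distribution, $$\Delta<1.48+\log\big(\log(1+\kappa)\big),\qquad \kappa=\max\Big\{\frac{P_x}{P_w},\frac{P_s}{P_w},1\Big\}.$$ -/

import Mathlib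

open MeasureTheory ProbabilityTheory Matrix
open scoped ComplexOrder

noncomputable section

/-- Entrywise expectation of a random complex matrix. -/
def matrixExpectation {Ω : Type*} [MeasurableSpace Ω] (μ : Measure Ω) {m n : ℕ}
    (A : Ω → Matrix (Fin m) (Fin n) ℂ) : Matrix (Fin m) (Fin n) ℂ :=
  Matrix.of fun i j => ∫ ω, A ω i j ∂μ

/-- Every entry of the random matrix `A` has a finite expectation. -/
def FiniteMatrixExpectation {Ω : Type*} [MeasurableSpace Ω] (μ : Measure Ω) {m n : ℕ}
    (A : Ω → Matrix (Fin m) (Fin n) ℂ) : Prop :=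
  ∀ i j, Integrable (fun ω => A ω i j) μ

/-- `log₂ det A`, for matrices whose determinant is a positive real number. -/
def logDet {M : ℕ} (A : Matrix (Fin M) (Fin M) ℂ) : ℝ :=
  Real.logb 2 A.det.re

/-- Signal-to-noise ratio per transmit antenna, `ρ = Px / (M Pw)`. -/
def snr (M : ℕ) (Px Pw : ℝ) : ℝ := Px / (M * Pw)

/-- The Gram matrix `Hᴴ H`. -/
def gramMatrix {N M : ℕ} (H : Matrix (Fin N) (Fin M) ℂ) : Matrix (Fin M) (Fin M) ℂ :=
  Hᴴ * H

/-- The matrix `I + ρ Hᴴ H`. -/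
def capacityMatrix {N M : ℕ} (Px Pw : ℝ) (H : Matrix (Fin N) (Fin M) ℂ) :
    Matrix (Fin M) (Fin M) ℂ :=
  1 + (snr M Px Pw : ℂ) • gramMatrix H

/-- The matrix `Px / (Px + M Ps) I + ρ Hᴴ H`. -/
def latticeMatrix {N M : ℕ} (Px Ps Pw : ℝ) (H : Matrix (Fin N) (Fin M) ℂ) :
    Matrix (Fin M) (Fin M) ℂ :=
  ((Px / (Px + M * Ps) : ℝ) : ℂ) • (1 : Matrix (Fin M) (Fin M) ℂ) + (snr M Px Pw : ℂ) • gramMatrix H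

/-- The dirt-free capacity `E[log det (I + ρ Hᴴ H)]`, in bits. -/
def dirtFreeCapacity {Ω : Type*} [MeasurableSpace Ω] (μ : Measure Ω) {N M : ℕ}
    (H : Ω → Matrix (Fin N) (Fin M) ℂ) (Px Pw : ℝ) : ℝ :=
  ∫ ω, logDet (capacityMatrix Px Pw (H ω)) ∂μ

/-- The matrix `E[(Px / (Px + M Ps) I + ρ Hᴴ H)⁻¹]`. -/
def latticeErrorMatrix {Ω : Type*} [MeasurableSpace Ω] (μ : Measure Ω) {N M : ℕ}
    (H : Ω → Matrix (Fin N) (Fin M) ℂ) (Px Ps Pw : ℝ) : Matrix (Fin M) (Fin M) ℂ :=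
  matrixExpectation μ fun ω => (latticeMatrix Px Ps Pw (H ω))⁻¹

/-- The lattice coding rate `(- log det E[(Px / (Px + M Ps) I + ρ Hᴴ H)⁻¹])⁺`, in bits. -/
def latticeRate {Ω : Type*} [MeasurableSpace Ω] (μ : Measure Ω) {N M : ℕ}
    (H : Ω → Matrix (Fin N) (Fin M) ℂ) (Px Ps Pw : ℝ) : ℝ :=
  max (-logDet (latticeErrorMatrix μ H Px Ps Pw)) 0

/-- The dirt-free capacity is finite and the lattice rate is meaningful: the expectations exist,
and the matrix whose log-determinant is taken is positive definite (hence has a positive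
determinant), as is, trivially, the matrix `I + ρ Hᴴ H`. -/
def RatesWellDefined {Ω : Type*} [MeasurableSpace Ω] (μ : Measure Ω) {N M : ℕ}
    (H : Ω → Matrix (Fin N) (Fin M) ℂ) (Px Ps Pw : ℝ) : Prop :=
  Integrable (fun ω => logDet (capacityMatrix Px Pw (H ω))) μ ∧
  FiniteMatrixExpectation μ (fun ω => (latticeMatrix Px Ps Pw (H ω))⁻¹) ∧
  (latticeErrorMatrix μ H Px Ps Pw).PosDef

/-- The gap, in bits, between the dirt-free capacity and the lattice rate. -/
def capacityGap {Ω : Type*} [MeasurableSpace Ω] (μ : Measure Ω) {N M : ℕ}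
    (H : Ω → Matrix (Fin N) (Fin M) ℂ) (Px Ps Pw : ℝ) : ℝ :=
  dirtFreeCapacity μ H Px Pw - latticeRate μ H Px Ps Pw

/-- The circularly symmetric complex Gaussian law with mean zero and unit variance:
real and imaginary part are independent real Gaussians of variance `1/2`. -/
def stdComplexGaussian : Measure ℂ :=
  ((gaussianReal 0 (1 / 2)).prod (gaussianReal 0 (1 / 2))).map
    fun p : ℝ × ℝ => (p.1 : ℂ) + (p.2 : ℂ) * Complex.I

/-- The entries of `H` are i.i.d. circularly symmetric complex Gaussian with mean zero and
unit variance. -/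
def IsIIDRayleigh {Ω : Type*} [MeasurableSpace Ω] (μ : Measure Ω) {N M : ℕ}
    (H : Ω → Matrix (Fin N) (Fin M) ℂ) : Prop :=
  iIndepFun (fun (p : Fin N × Fin M) (ω : Ω) => H ω p.1 p.2) μ ∧
  ∀ i j, μ.map (fun ω => H ω i j) = stdComplexGaussian

/-- The Nakagami law with shape `m` and spread `θ`. -/
def nakagamiMeasure (m θ : ℝ) : Measure ℝ :=
  (volume.restrict (Set.Ioi 0)).withDensity fun x => ENNReal.ofReal
    (2 * m ^ m / (Real.Gamma m * θ ^ m) * x ^ (2 * m - 1) * Real.exp (-(m / θ) * x ^ 2))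

/-- The Rayleigh law with scale `σ`. -/
def rayleighMeasure (σ : ℝ) : Measure ℝ :=
  (volume.restrict (Set.Ioi 0)).withDensity fun x => ENNReal.ofReal
    (x / σ ^ 2 * Real.exp (-x ^ 2 / (2 * σ ^ 2)))

end

/-! Write `G = Hᴴ H` and `c = Px / (Px + M Ps)`. Jensen's inequality for the concave function log
det (`integral_log_det_le`) bounds the capacity by `log det (I + ρ E[G])`. Dropping the positive
part bounds the rate below by `-log det E[(c I + ρ G)⁻¹]`.

For `ρ ≥ 1` one has `I + ρ E[G] ≤ ρ (I + E[G])`, and `(c I + ρ G)⁻¹ < ρ⁻¹ G⁻¹` strictly, because `c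
> 0`. The two powers of `ρ` cancel in the product of determinants, which gives the general bound
`capacityGap_lt_of_isUnit_gramMatrix`.

For i.i.d. Gaussian entries, AM-GM on eigenvalues replaces both determinants by traces. The trace of
`E[G]` is `N M`. The reciprocal of `(G⁻¹) j j` is the squared distance from column `j` to the span
of the other columns. By rotation invariance and independence this dominates a Gamma variable of
shape `N - M + 1`, whose reciprocal has mean `1 / (N - M)`.

In the scalar cases, `ρ < 1` is immediate since the capacity itself is below one bit. For Nakagami
fading with `ρ ≥ 1` the general bound applies with `E[|h|⁻²] = m / (m - 1)`. For Rayleigh fading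
`E[|h|⁻²]` diverges, so the regularizer is kept: `E[(a + |h|²)⁻¹] ≤ log (1 + 1 / a)` with `a = Pw /
(Px + Ps)`, which yields the iterated logarithm. -/

theorem Matrix.PosSemidef.trace_re_nonneg {n : Type*} [Fintype n] {A : Matrix n n ℂ}
    (hA : A.PosSemidef) : 0 ≤ A.trace.re :=
  (Complex.le_def.mp hA.trace_nonneg).1

/-! ### Determinant and trace inequalities for positive definite matrices -/

section MatrixLemmas

variable {n : Type*} [Fintype n] [DecidableEq n]

theorem Matrix.PosSemidef.exists_eq_conjTranspose_mul_self {A : Matrix n n ℂ} (hA : A.PosSemidef) :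
    ∃ B : Matrix n n ℂ, A = Bᴴ * B := by
  open scoped MatrixOrder Matrix.Norms.L2Operator in
  exact CStarAlgebra.nonneg_iff_eq_star_mul_self.mp hA.nonneg

theorem Matrix.PosDef.exists_eq_conjTranspose_mul_self {A : Matrix n n ℂ} (hA : A.PosDef) :
    ∃ B : Matrix n n ℂ, IsUnit B ∧ A = Bᴴ * B := by
  obtain ⟨B, rfl⟩ := hA.posSemidef.exists_eq_conjTranspose_mul_self
  refine ⟨B, ?_, rfl⟩
  rw [Matrix.isUnit_iff_isUnit_det]
  have h := (Matrix.isUnit_iff_isUnit_det _).mp hA.isUnit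
  rw [Matrix.det_mul] at h
  exact isUnit_of_mul_isUnit_right h

theorem Matrix.PosDef.det_re_pos {A : Matrix n n ℂ} (hA : A.PosDef) : 0 < A.det.re :=
  (Complex.lt_def.mp hA.det_pos).1

theorem Matrix.PosDef.det_eq_re {A : Matrix n n ℂ} (hA : A.PosDef) : A.det = (A.det.re : ℂ) :=
  Complex.ext rfl (by simpa using (Complex.lt_def.mp hA.det_pos).2.symm)

theorem Matrix.PosDef.mul_det_re {A B : Matrix n n ℂ} (hA : A.PosDef) (hB : B.PosDef) :
    (A * B).det.re = A.det.re * B.det.re := by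
  rw [Matrix.det_mul, hA.det_eq_re, hB.det_eq_re, ← Complex.ofReal_mul, Complex.ofReal_re,
    Complex.ofReal_re, Complex.ofReal_re]

/-- `log det X ≤ tr X - n` for positive definite `X`. -/
theorem Matrix.PosDef.log_det_le_trace_sub_card {X : Matrix n n ℂ} (hX : X.PosDef) :
    Real.log X.det.re ≤ X.trace.re - Fintype.card n := by
  have h1 : X.det.re = ∏ i, hX.1.eigenvalues i := by
    rw [hX.1.det_eq_prod_eigenvalues]
    exact_mod_cast Complex.ofReal_re _
  have h2 : X.trace.re = ∑ i, hX.1.eigenvalues i := by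
    rw [hX.1.trace_eq_sum_eigenvalues]
    exact_mod_cast Complex.ofReal_re _
  rw [h1, h2, Real.log_prod fun i _ => (hX.eigenvalues_pos i).ne']
  have : ∑ i, Real.log (hX.1.eigenvalues i) ≤ ∑ i, (hX.1.eigenvalues i - 1) :=
    Finset.sum_le_sum fun i _ => Real.log_le_sub_one_of_pos (hX.eigenvalues_pos i)
  simpa using this

/-- The tangent inequality expressing the concavity of `log det`. -/
theorem Matrix.PosDef.log_det_le_log_det_add {A B : Matrix n n ℂ} (hA : A.PosDef)
    (hB : B.PosDef) :
    Real.log A.det.re ≤ Real.log B.det.re + (B⁻¹ * A).trace.re - Fintype.card n := by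
  -- Whitening: with `B⁻¹ = Cᴴ C`, the matrix `C A Cᴴ` is positive definite and has the trace and
  -- determinant of `B⁻¹ A`.
  obtain ⟨C, hC, hCB⟩ := hB.inv.exists_eq_conjTranspose_mul_self
  have hX : (C * A * Cᴴ).PosDef := hA.mul_mul_conjTranspose_same (by
    rw [Matrix.vecMul_injective_iff_isUnit]; exact hC)
  have h := hX.log_det_le_trace_sub_card
  have htr : (C * A * Cᴴ).trace = (B⁻¹ * A).trace := by
    rw [Matrix.trace_mul_cycle, ← hCB]
  have hdet : (C * A * Cᴴ).det = (B⁻¹ * A).det := by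
    rw [hCB]; simp only [Matrix.det_mul]; ring
  have hinv : B⁻¹.det.re = B.det.re⁻¹ := by
    have : B⁻¹.det.re * B.det.re = 1 := by
      rw [← hB.inv.mul_det_re hB, Matrix.nonsing_inv_mul _
        ((Matrix.isUnit_iff_isUnit_det _).mp hB.isUnit)]
      simp
    exact eq_inv_of_mul_eq_one_left this
  rw [htr, hdet, hB.inv.mul_det_re hA, hinv, Real.log_mul (inv_ne_zero hB.det_re_pos.ne')
    hA.det_re_pos.ne', Real.log_inv] at h
  linarith

/-- With `A = Cᴴ C`, cyclicity turns the trace into that of `C B Cᴴ`, a congruence of `B` by an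
invertible matrix. -/
theorem Matrix.PosDef.trace_mul_re_pos [Nonempty n] {A B : Matrix n n ℂ} (hA : A.PosDef)
    (hB : B.PosDef) : 0 < (A * B).trace.re := by
  obtain ⟨C, hC, rfl⟩ := hA.exists_eq_conjTranspose_mul_self
  have hX : (C * B * Cᴴ).PosDef := hB.mul_mul_conjTranspose_same (by
    rw [Matrix.vecMul_injective_iff_isUnit]; exact hC)
  rw [← Matrix.trace_mul_cycle]
  exact (Complex.lt_def.mp hX.trace_pos).1

theorem Matrix.PosDef.trace_mul_re_nonneg {A B : Matrix n n ℂ} (hA : A.PosDef)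
    (hB : B.PosSemidef) : 0 ≤ (A * B).trace.re := by
  obtain ⟨C, hC, rfl⟩ := hA.exists_eq_conjTranspose_mul_self
  rw [← Matrix.trace_mul_cycle]
  exact (hB.mul_mul_conjTranspose_same C).trace_re_nonneg

/-- Monotonicity of `log det`. -/
theorem Matrix.PosDef.log_det_le_log_det {A B : Matrix n n ℂ} (hA : A.PosDef)
    (hBA : (B - A).PosSemidef) : Real.log A.det.re ≤ Real.log B.det.re := by
  have hB : B.PosDef := by simpa using hA.add_posSemidef hBA
  have h1 := hA.log_det_le_log_det_add hB
  have h2 := hB.inv.trace_mul_re_nonneg hBA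
  rw [Matrix.mul_sub, Matrix.nonsing_inv_mul _
    ((Matrix.isUnit_iff_isUnit_det _).mp hB.isUnit)] at h2
  simp only [Matrix.trace_sub, Matrix.trace_one, Complex.sub_re, Complex.natCast_re] at h2
  linarith

/-- Strict monotonicity of `log det`. -/
theorem Matrix.PosDef.log_det_lt_log_det [Nonempty n] {A B : Matrix n n ℂ} (hA : A.PosDef)
    (hBA : (B - A).PosDef) : Real.log A.det.re < Real.log B.det.re := by
  have hB : B.PosDef := by simpa using hBA.add hA
  have h1 := hA.log_det_le_log_det_add hB
  have h2 := hB.inv.trace_mul_re_pos hBA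
  rw [Matrix.mul_sub, Matrix.nonsing_inv_mul _
    ((Matrix.isUnit_iff_isUnit_det _).mp hB.isUnit)] at h2
  simp only [Matrix.trace_sub, Matrix.trace_one, Complex.sub_re, Complex.natCast_re] at h2
  linarith

/-- The determinant is controlled by the trace: the AM-GM inequality for eigenvalues. -/
theorem Matrix.PosDef.log_det_le_of_trace_le {A : Matrix n n ℂ} (hA : A.PosDef) {t : ℝ}
    (ht : 0 < t) (h : A.trace.re ≤ Fintype.card n * t) :
    Real.log A.det.re ≤ Fintype.card n * Real.log t := by
  have hX : (((t⁻¹ : ℝ) : ℂ) • A).PosDef :=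
    hA.smul (by exact_mod_cast inv_pos.mpr ht)
  have h1 := hX.log_det_le_trace_sub_card
  rw [Matrix.det_smul, ← Complex.ofReal_pow, Complex.re_ofReal_mul, Matrix.trace_smul, smul_eq_mul,
    Complex.re_ofReal_mul, Real.log_mul (by positivity) hA.det_re_pos.ne', Real.log_pow,
    Real.log_inv] at h1
  have h2 : t⁻¹ * A.trace.re ≤ Fintype.card n := by
    rw [inv_mul_le_iff₀ ht]; linarith
  linarith

/-- An entry of `Bᴴ B` is an inner product of two columns of `B`, hence at most the mean of their
squared norms, each of which is at most the trace. This reduces integrability of all entries to that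
of one scalar. -/
theorem Matrix.PosSemidef.norm_entry_le_trace {A : Matrix n n ℂ} (hA : A.PosSemidef) (i j : n) :
    ‖A i j‖ ≤ A.trace.re := by
  obtain ⟨B, rfl⟩ := hA.exists_eq_conjTranspose_mul_self
  have hd : ∀ k, (Bᴴ * B) k k = ((∑ l, ‖B l k‖ ^ 2 : ℝ) : ℂ) := fun k => by
    simp only [Matrix.mul_apply, Matrix.conjTranspose_apply, Complex.ofReal_sum, Complex.star_def,
      Complex.conj_mul', Complex.ofReal_pow]
  have htr : (Bᴴ * B).trace.re = ∑ k, ∑ l, ‖B l k‖ ^ 2 := by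
    simp only [Matrix.trace, Matrix.diag_apply, hd]
    rw [← Complex.ofReal_sum, Complex.ofReal_re]
  have hle : ∀ k, ∑ l, ‖B l k‖ ^ 2 ≤ ∑ k, ∑ l, ‖B l k‖ ^ 2 := fun k =>
    Finset.single_le_sum (f := fun k => ∑ l, ‖B l k‖ ^ 2) (fun _ _ => by positivity)
      (Finset.mem_univ k)
  have h1 : ‖(Bᴴ * B) i j‖ ≤ ∑ l, (‖B l i‖ ^ 2 + ‖B l j‖ ^ 2) / 2 := by
    rw [Matrix.mul_apply]
    refine (norm_sum_le _ _).trans (Finset.sum_le_sum fun l _ => ?_)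
    rw [norm_mul, Matrix.conjTranspose_apply, norm_star]
    nlinarith [sq_nonneg (‖B l i‖ - ‖B l j‖)]
  rw [htr]
  rw [← Finset.sum_div, Finset.sum_add_distrib] at h1
  linarith [hle i, hle j]

/-- `c (c I + S)⁻¹ ≤ I`, in trace form. -/
theorem Matrix.PosSemidef.trace_inv_smul_one_add_le {S : Matrix n n ℂ} (hS : S.PosSemidef) {c : ℝ}
    (hc : 0 < c) :
    (((c : ℂ) • (1 : Matrix n n ℂ) + S)⁻¹).trace.re ≤ Fintype.card n / c := by
  have hc' : (0 : ℂ) < c := by exact_mod_cast hc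
  have hA : ((c : ℂ) • (1 : Matrix n n ℂ) + S).PosDef :=
    (Matrix.PosDef.one.smul hc').add_posSemidef hS
  have hu := (Matrix.isUnit_iff_isUnit_det _).mp hA.isUnit
  have hB := hA.inv
  set B := ((c : ℂ) • (1 : Matrix n n ℂ) + S)⁻¹ with hBdef
  have hAB : (c : ℂ) • B + S * B = 1 := by
    have := Matrix.mul_nonsing_inv _ hu
    rwa [← hBdef, Matrix.add_mul, smul_mul_assoc, one_mul] at this
  have hBA : (c : ℂ) • B + B * S = 1 := by
    have := Matrix.nonsing_inv_mul _ hu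
    rwa [← hBdef, Matrix.mul_add, mul_smul_comm, mul_one] at this
  have hps : (1 - (c : ℂ) • B).PosSemidef := by
    have h2 : (S * S).PosSemidef := by
      have := Matrix.posSemidef_conjTranspose_mul_self S
      rwa [hS.1.eq] at this
    -- Since `S` commutes with `B`, inserting `1 = c B + S B` makes `1 - c B = S B` a congruence of
    -- the positive semidefinite `c S + S²`.
    have h3 : 1 - (c : ℂ) • B = Bᴴ * ((c : ℂ) • S + S * S) * B := by
      rw [hB.1.eq]
      have e1 : 1 - (c : ℂ) • B = S * B := by rw [← hAB]; abel
      have e2 : B * S = S * B := by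
        have := hAB.trans hBA.symm
        exact (add_left_cancel this).symm
      calc 1 - (c : ℂ) • B = S * B := e1
        _ = (B * S) * 1 := by rw [e2, mul_one]
        _ = (B * S) * ((c : ℂ) • B + S * B) := by rw [hAB]
        _ = _ := by
          simp only [mul_add, add_mul, mul_smul_comm, smul_mul_assoc, mul_assoc]
    rw [h3]
    exact ((hS.smul hc'.le).add h2).conjTranspose_mul_mul_same B
  have := hps.trace_re_nonneg
  rw [Matrix.trace_sub, Matrix.trace_smul, Matrix.trace_one, Complex.sub_re, smul_eq_mul,
    Complex.re_ofReal_mul, Complex.natCast_re] at this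
  rw [le_div_iff₀ hc]
  linarith

/-- Adding a positive multiple of the identity strictly decreases the inverse. -/
theorem Matrix.PosDef.inv_sub_inv_smul_one_add {S : Matrix n n ℂ} (hS : S.PosDef) {c : ℝ}
    (hc : 0 < c) : (S⁻¹ - ((c : ℂ) • (1 : Matrix n n ℂ) + S)⁻¹).PosDef := by
  have hc' : (0 : ℂ) < c := by exact_mod_cast hc
  have hA : ((c : ℂ) • (1 : Matrix n n ℂ) + S).PosDef :=
    (Matrix.PosDef.one.smul hc').add hS
  have hu := (Matrix.isUnit_iff_isUnit_det _).mp hA.isUnit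
  have hv := (Matrix.isUnit_iff_isUnit_det _).mp hS.isUnit
  have h2 : (S * S).PosSemidef := by
    have := Matrix.posSemidef_conjTranspose_mul_self S
    rwa [hS.1.eq] at this
  have hK : ((c : ℂ) • (((c : ℂ) • S + S * S)⁻¹)).PosDef :=
    (((hS.smul hc').add_posSemidef h2).inv).smul hc'
  convert hK using 1
  -- Resolvent identity: with `A = c I + S`, `S⁻¹ - A⁻¹ = S⁻¹ (A - S) A⁻¹ = c (A S)⁻¹`.
  have hfac : (c : ℂ) • S + S * S = ((c : ℂ) • (1 : Matrix n n ℂ) + S) * S := by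
    rw [add_mul, smul_mul_assoc, one_mul]
  rw [hfac, Matrix.mul_inv_rev]
  calc _ = S⁻¹ * (((c : ℂ) • (1 : Matrix n n ℂ) + S) - S) *
          ((c : ℂ) • (1 : Matrix n n ℂ) + S)⁻¹ := by
        rw [mul_sub, sub_mul, mul_assoc, Matrix.mul_nonsing_inv _ hu, mul_one,
          Matrix.nonsing_inv_mul _ hv, one_mul]
    _ = _ := by rw [add_sub_cancel_right, mul_smul_comm, mul_one, smul_mul_assoc]

end MatrixLemmas

/-! ### Measurability of determinants and inverses -/

section Measurability

variable {Ω : Type*} [MeasurableSpace Ω] {n : Type*} [Fintype n] [DecidableEq n]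

theorem measurable_matrix_det {A : Ω → Matrix n n ℂ} (hA : ∀ i j, Measurable fun ω => A ω i j) :
    Measurable fun ω => (A ω).det := by
  simp only [Matrix.det_apply, Units.smul_def, zsmul_eq_mul]
  fun_prop

/-- Cramer's formula also covers singular matrices, where both sides are zero by convention. -/
theorem measurable_matrix_inv {A : Ω → Matrix n n ℂ} (hA : ∀ i j, Measurable fun ω => A ω i j)
    (i j : n) : Measurable fun ω => (A ω)⁻¹ i j := by
  simp only [Matrix.inv_def, Matrix.smul_apply, Matrix.adjugate_apply, smul_eq_mul,
    Ring.inverse_eq_inv']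
  refine (measurable_matrix_det hA).inv.mul (measurable_matrix_det fun k l => ?_)
  by_cases h : k = j
  · subst h; simp
  · simpa [Matrix.updateRow_ne h] using hA k l

end Measurability

/-! ### Entrywise expectations, definiteness and Jensen's inequality -/

section Expectation

variable {Ω : Type*} [MeasurableSpace Ω] {μ : Measure Ω} {m n M : ℕ}

theorem FiniteMatrixExpectation.add {A B : Ω → Matrix (Fin m) (Fin n) ℂ}
    (hA : FiniteMatrixExpectation μ A) (hB : FiniteMatrixExpectation μ B) :
    FiniteMatrixExpectation μ fun ω => A ω + B ω :=
  fun i j => (hA i j).add (hB i j)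

theorem FiniteMatrixExpectation.sub {A B : Ω → Matrix (Fin m) (Fin n) ℂ}
    (hA : FiniteMatrixExpectation μ A) (hB : FiniteMatrixExpectation μ B) :
    FiniteMatrixExpectation μ fun ω => A ω - B ω :=
  fun i j => (hA i j).sub (hB i j)

theorem FiniteMatrixExpectation.smul {A : Ω → Matrix (Fin m) (Fin n) ℂ}
    (hA : FiniteMatrixExpectation μ A) (c : ℂ) :
    FiniteMatrixExpectation μ fun ω => c • A ω :=
  fun i j => (hA i j).const_mul c

theorem finiteMatrixExpectation_const [IsProbabilityMeasure μ] (A : Matrix (Fin m) (Fin n) ℂ) :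
    FiniteMatrixExpectation μ fun _ => A :=
  fun _ _ => integrable_const _

theorem matrixExpectation_add {A B : Ω → Matrix (Fin m) (Fin n) ℂ}
    (hA : FiniteMatrixExpectation μ A) (hB : FiniteMatrixExpectation μ B) :
    matrixExpectation μ (fun ω => A ω + B ω) = matrixExpectation μ A + matrixExpectation μ B := by
  ext i j
  exact integral_add (hA i j) (hB i j)

theorem matrixExpectation_sub {A B : Ω → Matrix (Fin m) (Fin n) ℂ}
    (hA : FiniteMatrixExpectation μ A) (hB : FiniteMatrixExpectation μ B) :
    matrixExpectation μ (fun ω => A ω - B ω) = matrixExpectation μ A - matrixExpectation μ B := by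
  ext i j
  exact integral_sub (hA i j) (hB i j)

theorem matrixExpectation_smul (A : Ω → Matrix (Fin m) (Fin n) ℂ) (c : ℂ) :
    matrixExpectation μ (fun ω => c • A ω) = c • matrixExpectation μ A := by
  ext i j
  exact integral_const_mul c _

theorem matrixExpectation_const [IsProbabilityMeasure μ] (A : Matrix (Fin m) (Fin n) ℂ) :
    matrixExpectation μ (fun _ => A) = A := by
  ext i j
  simp [matrixExpectation]

theorem integrable_dotProduct_mulVec {A : Ω → Matrix (Fin M) (Fin M) ℂ}
    (hA : FiniteMatrixExpectation μ A) (x y : Fin M → ℂ) :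
    Integrable (fun ω => x ⬝ᵥ A ω *ᵥ y) μ := by
  simp only [dotProduct, mulVec]
  exact integrable_finsetSum _ fun i _ => (integrable_finsetSum _ fun j _ =>
    (hA i j).mul_const _).const_mul _

theorem dotProduct_matrixExpectation_mulVec {A : Ω → Matrix (Fin M) (Fin M) ℂ}
    (hA : FiniteMatrixExpectation μ A) (x y : Fin M → ℂ) :
    x ⬝ᵥ matrixExpectation μ A *ᵥ y = ∫ ω, x ⬝ᵥ A ω *ᵥ y ∂μ := by
  simp only [dotProduct, mulVec]
  rw [integral_finsetSum _ fun i _ => (integrable_finsetSum _ fun j _ =>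
    (hA i j).mul_const _).const_mul _]
  refine Finset.sum_congr rfl fun i _ => ?_
  rw [integral_const_mul, integral_finsetSum _ fun j _ => (hA i j).mul_const _]
  congr 1
  refine Finset.sum_congr rfl fun j _ => ?_
  rw [integral_mul_const]
  rfl

theorem integrable_trace_mul {A : Ω → Matrix (Fin M) (Fin M) ℂ}
    (hA : FiniteMatrixExpectation μ A) (B : Matrix (Fin M) (Fin M) ℂ) :
    Integrable (fun ω => (B * A ω).trace.re) μ := by
  refine Integrable.re (𝕜 := ℂ) ?_
  simp only [Matrix.trace, Matrix.diag_apply, Matrix.mul_apply]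
  exact integrable_finsetSum _ fun i _ => integrable_finsetSum _ fun j _ =>
    (hA j i).const_mul _

theorem trace_mul_matrixExpectation {A : Ω → Matrix (Fin M) (Fin M) ℂ}
    (hA : FiniteMatrixExpectation μ A) (B : Matrix (Fin M) (Fin M) ℂ) :
    (B * matrixExpectation μ A).trace.re = ∫ ω, (B * A ω).trace.re ∂μ := by
  have h : (B * matrixExpectation μ A).trace = ∫ ω, (B * A ω).trace ∂μ := by
    simp only [Matrix.trace, Matrix.diag_apply, Matrix.mul_apply]
    rw [integral_finsetSum _ fun i _ => integrable_finsetSum _ fun j _ =>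
      (hA j i).const_mul (B i j)]
    refine Finset.sum_congr rfl fun i _ => ?_
    rw [integral_finsetSum _ fun j _ => (hA j i).const_mul (B i j)]
    refine Finset.sum_congr rfl fun j _ => ?_
    rw [integral_const_mul]
    rfl
  have hi : Integrable (fun ω => (B * A ω).trace) μ := by
    simp only [Matrix.trace, Matrix.diag_apply, Matrix.mul_apply]
    exact integrable_finsetSum _ fun i _ => integrable_finsetSum _ fun j _ => (hA j i).const_mul _
  rw [h]
  exact (integral_re hi).symm

theorem isHermitian_matrixExpectation {A : Ω → Matrix (Fin M) (Fin M) ℂ}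
    (h : ∀ᵐ ω ∂μ, (A ω).IsHermitian) : (matrixExpectation μ A).IsHermitian := by
  ext i j
  simp only [Matrix.conjTranspose_apply, matrixExpectation, Matrix.of_apply, Complex.star_def]
  rw [← integral_conj]
  exact integral_congr_ae (h.mono fun ω hω => by simpa using hω.apply i j)

theorem posSemidef_matrixExpectation {A : Ω → Matrix (Fin M) (Fin M) ℂ}
    (hA : FiniteMatrixExpectation μ A) (h : ∀ᵐ ω ∂μ, (A ω).PosSemidef) :
    (matrixExpectation μ A).PosSemidef := by
  refine .of_dotProduct_mulVec_nonneg
    (isHermitian_matrixExpectation (h.mono fun ω hω => hω.1)) fun x => ?_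
  rw [dotProduct_matrixExpectation_mulVec hA]
  have : ∫ ω, star x ⬝ᵥ A ω *ᵥ x ∂μ = ((∫ ω, (star x ⬝ᵥ A ω *ᵥ x).re ∂μ : ℝ) : ℂ) := by
    rw [← integral_complex_ofReal]
    exact integral_congr_ae (h.mono fun ω hω =>
      Complex.ext rfl (by simpa using (Complex.le_def.mp (hω.dotProduct_mulVec_nonneg x)).2.symm))
  rw [this]
  exact_mod_cast integral_nonneg_of_ae (h.mono fun ω hω =>
    (Complex.le_def.mp (hω.dotProduct_mulVec_nonneg x)).1)

theorem posDef_matrixExpectation [IsProbabilityMeasure μ] {A : Ω → Matrix (Fin M) (Fin M) ℂ}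
    (hA : FiniteMatrixExpectation μ A) (h : ∀ᵐ ω ∂μ, (A ω).PosDef) :
    (matrixExpectation μ A).PosDef := by
  have hps := posSemidef_matrixExpectation hA (h.mono fun ω hω => hω.posSemidef)
  refine .of_dotProduct_mulVec_pos hps.1 fun x hx => ?_
  have h0 := hps.dotProduct_mulVec_nonneg x
  have hpos : 0 < ∫ ω, (star x ⬝ᵥ A ω *ᵥ x).re ∂μ := by
    have hae : ∀ᵐ ω ∂μ, 0 < (star x ⬝ᵥ A ω *ᵥ x).re :=
      h.mono fun ω hω => (Complex.lt_def.mp (hω.dotProduct_mulVec_pos hx)).1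
    have hint := (integrable_dotProduct_mulVec hA (star x) x).re
    -- A zero integral would force the almost surely positive quadratic form to vanish almost
    -- surely, impossible under a probability measure.
    refine lt_of_le_of_ne (integral_nonneg_of_ae (hae.mono fun ω hω => hω.le)) fun h0 => ?_
    have hz := (integral_eq_zero_iff_of_nonneg_ae (hae.mono fun ω hω => hω.le) hint).mp h0.symm
    obtain ⟨ω, h1, h2⟩ := (hae.and hz).exists
    exact h1.ne' h2
  have hre : (star x ⬝ᵥ matrixExpectation μ A *ᵥ x).re = ∫ ω, (star x ⬝ᵥ A ω *ᵥ x).re ∂μ := by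
    rw [dotProduct_matrixExpectation_mulVec hA]
    exact (integral_re (integrable_dotProduct_mulVec hA (star x) x)).symm
  refine Complex.lt_def.mpr ⟨?_, (Complex.le_def.mp h0).2⟩
  rw [hre]
  exact hpos

/-- Positive semidefinite random matrices are integrable as soon as their trace is dominated by an
integrable function. -/
theorem finiteMatrixExpectation_of_trace_le {A : Ω → Matrix (Fin M) (Fin M) ℂ}
    (hm : ∀ i j, AEStronglyMeasurable (fun ω => A ω i j) μ) {g : Ω → ℝ} (hg : Integrable g μ)
    (h : ∀ᵐ ω ∂μ, (A ω).PosSemidef ∧ (A ω).trace.re ≤ g ω) : FiniteMatrixExpectation μ A :=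
  fun i j => hg.mono' (hm i j) (h.mono fun _ hω => (hω.1.norm_entry_le_trace i j).trans hω.2)

/-- Jensen's inequality for `log det`. -/
theorem integral_log_det_le [IsProbabilityMeasure μ] {A : Ω → Matrix (Fin M) (Fin M) ℂ}
    (hA : FiniteMatrixExpectation μ A) (h : ∀ᵐ ω ∂μ, (A ω).PosDef)
    (hlog : Integrable (fun ω => Real.log (A ω).det.re) μ) :
    ∫ ω, Real.log (A ω).det.re ∂μ ≤ Real.log (matrixExpectation μ A).det.re := by
  have hE := posDef_matrixExpectation hA h
  set B := matrixExpectation μ A with hB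
  -- Take the tangent at `B = E[A]`: its linear term has expectation `tr (B⁻¹ B) = M`, which cancels
  -- the constant.
  have hsum : Integrable (fun ω => Real.log B.det.re + (B⁻¹ * A ω).trace.re) μ :=
    (integrable_const _).add (integrable_trace_mul hA _)
  have hint : Integrable (fun ω => Real.log B.det.re + (B⁻¹ * A ω).trace.re - M) μ :=
    hsum.sub (integrable_const _)
  have h1 : ∫ ω, Real.log (A ω).det.re ∂μ ≤
      ∫ ω, (Real.log B.det.re + (B⁻¹ * A ω).trace.re - M) ∂μ :=
    integral_mono_ae hlog hint (h.mono fun ω hω => by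
      simpa using hω.log_det_le_log_det_add hE)
  refine h1.trans_eq ?_
  rw [integral_sub hsum (integrable_const _),
    integral_add (integrable_const _) (integrable_trace_mul hA _), ← trace_mul_matrixExpectation hA,
    ← hB, Matrix.nonsing_inv_mul _ ((Matrix.isUnit_iff_isUnit_det _).mp hE.isUnit)]
  simp

end Expectation

/-! ### Channel matrices: positivity and measurability -/

theorem logDet_eq_log_div {M : ℕ} (A : Matrix (Fin M) (Fin M) ℂ) :
    logDet A = Real.log A.det.re / Real.log 2 := rfl

theorem logDet_mul {M : ℕ} {A B : Matrix (Fin M) (Fin M) ℂ} (hA : A.PosDef) (hB : B.PosDef) :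
    logDet (A * B) = logDet A + logDet B := by
  rw [logDet, hA.mul_det_re hB, Real.logb_mul hA.det_re_pos.ne' hB.det_re_pos.ne']
  rfl

theorem snr_pos {M : ℕ} (hM : 1 ≤ M) {Px Pw : ℝ} (hPx : 0 < Px) (hPw : 0 < Pw) :
    0 < snr M Px Pw := by
  have : (0 : ℝ) < M := by exact_mod_cast hM
  exact div_pos hPx (mul_pos this hPw)

theorem posSemidef_gramMatrix {N M : ℕ} (H : Matrix (Fin N) (Fin M) ℂ) :
    (gramMatrix H).PosSemidef :=
  Matrix.posSemidef_conjTranspose_mul_self H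

theorem posDef_one_add_smul_gramMatrix {N M : ℕ} (H : Matrix (Fin N) (Fin M) ℂ) {ρ : ℝ}
    (hρ : 0 ≤ ρ) : (1 + (ρ : ℂ) • gramMatrix H).PosDef :=
  Matrix.PosDef.one.add_posSemidef ((posSemidef_gramMatrix H).smul (by exact_mod_cast hρ))

theorem measurable_gramMatrix {Ω : Type*} [MeasurableSpace Ω] {N M : ℕ}
    {H : Ω → Matrix (Fin N) (Fin M) ℂ} (hH : ∀ i j, Measurable fun ω => H ω i j) (i j : Fin M) :
    Measurable fun ω => gramMatrix (H ω) i j := by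
  simp only [gramMatrix, Matrix.mul_apply, Matrix.conjTranspose_apply, Complex.star_def]
  exact Finset.measurable_sum _ fun k _ =>
    (Complex.continuous_conj.measurable.comp (hH k i)).mul (hH k j)

theorem regularizer_pos {M : ℕ} {Px Ps : ℝ} (hPx : 0 < Px) (hPs : 0 < Ps) :
    0 < Px / (Px + M * Ps) := by positivity

theorem posDef_latticeMatrix {N M : ℕ} {Px Ps Pw : ℝ} (hPx : 0 < Px) (hPs : 0 < Ps)
    (hρ : 0 ≤ snr M Px Pw) (H : Matrix (Fin N) (Fin M) ℂ) : (latticeMatrix Px Ps Pw H).PosDef :=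
  (Matrix.PosDef.one.smul (by exact_mod_cast regularizer_pos hPx hPs)).add_posSemidef
    ((posSemidef_gramMatrix H).smul (by exact_mod_cast hρ))

/-! ### Capacity and rate bounds for general fading -/

section Fading

variable {Ω : Type*} [MeasurableSpace Ω] {μ : Measure Ω} [IsProbabilityMeasure μ] {N M : ℕ}
  {H : Ω → Matrix (Fin N) (Fin M) ℂ} {Px Ps Pw : ℝ}

/-- The integrand lies between `0` and `tr (ρ G)`, which is integrable. -/
theorem integrable_log_det_capacity (hH : ∀ i j, Measurable fun ω => H ω i j)
    (hG : FiniteMatrixExpectation μ fun ω => gramMatrix (H ω)) {ρ : ℝ} (hρ : 0 ≤ ρ) :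
    Integrable (fun ω => Real.log (1 + (ρ : ℂ) • gramMatrix (H ω)).det.re) μ := by
  have hfin : FiniteMatrixExpectation μ fun ω => (1 : Matrix (Fin M) (Fin M) ℂ) +
      (ρ : ℂ) • gramMatrix (H ω) := (finiteMatrixExpectation_const 1).add (hG.smul _)
  have hbd : Integrable (fun ω => (1 * (1 + (ρ : ℂ) • gramMatrix (H ω))).trace.re - (M : ℝ)) μ :=
    (integrable_trace_mul hfin 1).sub (integrable_const _)
  refine hbd.mono' ?_ (ae_of_all _ fun ω => ?_)
  · refine (Real.measurable_log.comp (Complex.measurable_re.comp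
      (measurable_matrix_det fun i j => ?_))).aestronglyMeasurable
    simp only [Matrix.add_apply, Matrix.smul_apply]
    exact measurable_const.add ((measurable_gramMatrix hH i j).const_mul _)
  · have hpd := posDef_one_add_smul_gramMatrix (H ω) hρ
    have h0 : 0 ≤ Real.log (1 + (ρ : ℂ) • gramMatrix (H ω)).det.re := by
      have := (Matrix.PosDef.one (n := Fin M) (R := ℂ)).log_det_le_log_det
        (B := 1 + (ρ : ℂ) • gramMatrix (H ω)) (by
          rw [add_sub_cancel_left]
          exact (posSemidef_gramMatrix (H ω)).smul (by exact_mod_cast hρ))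
      simpa using this
    rw [Real.norm_of_nonneg h0, one_mul]
    simpa using hpd.log_det_le_trace_sub_card

theorem dirtFreeCapacity_le (hH : ∀ i j, Measurable fun ω => H ω i j)
    (hG : FiniteMatrixExpectation μ fun ω => gramMatrix (H ω)) (hρ : 0 ≤ snr M Px Pw) :
    dirtFreeCapacity μ H Px Pw ≤
      logDet (1 + (snr M Px Pw : ℂ) • matrixExpectation μ fun ω => gramMatrix (H ω)) := by
  have h1 : FiniteMatrixExpectation μ fun _ : Ω => (1 : Matrix (Fin M) (Fin M) ℂ) :=
    finiteMatrixExpectation_const 1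
  have hfin := h1.add (hG.smul (snr M Px Pw : ℂ))
  have h := integral_log_det_le hfin
    (ae_of_all _ fun ω => posDef_one_add_smul_gramMatrix (H ω) hρ)
    (integrable_log_det_capacity hH hG hρ)
  rw [matrixExpectation_add h1 (hG.smul _), matrixExpectation_const, matrixExpectation_smul] at h
  simp only [dirtFreeCapacity, logDet_eq_log_div, capacityMatrix]
  rw [integral_div]
  exact div_le_div_of_nonneg_right h (Real.log_nonneg one_le_two)

/-- The regularizer bounds the trace of the inverse by a constant, so no moment or invertibility
assumption is needed. -/
theorem finiteMatrixExpectation_latticeMatrix_inv (hPx : 0 < Px) (hPs : 0 < Ps)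
    (hρ : 0 ≤ snr M Px Pw) (hH : ∀ i j, Measurable fun ω => H ω i j) :
    FiniteMatrixExpectation μ fun ω => (latticeMatrix Px Ps Pw (H ω))⁻¹ := by
  refine finiteMatrixExpectation_of_trace_le (fun i j => ?_)
    (integrable_const ((M : ℝ) / (Px / (Px + M * Ps)))) (ae_of_all _ fun ω => ⟨?_, ?_⟩)
  · refine (measurable_matrix_inv (fun i j => ?_) i j).aestronglyMeasurable
    simp only [latticeMatrix, Matrix.add_apply, Matrix.smul_apply]
    exact measurable_const.add ((measurable_gramMatrix hH i j).const_mul _)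
  · exact (posDef_latticeMatrix hPx hPs hρ (H ω)).inv.posSemidef
  · have h := ((posSemidef_gramMatrix (H ω)).smul
      (by exact_mod_cast hρ : (0 : ℂ) ≤ (snr M Px Pw : ℂ))).trace_inv_smul_one_add_le
      (regularizer_pos (M := M) hPx hPs)
    rwa [Fintype.card_fin] at h

theorem ratesWellDefined (hPx : 0 < Px) (hPs : 0 < Ps)
    (hρ : 0 ≤ snr M Px Pw) (hH : ∀ i j, Measurable fun ω => H ω i j)
    (hG : FiniteMatrixExpectation μ fun ω => gramMatrix (H ω)) :
    RatesWellDefined μ H Px Ps Pw := by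
  have hL := finiteMatrixExpectation_latticeMatrix_inv (μ := μ) hPx hPs hρ hH
  exact ⟨(integrable_log_det_capacity hH hG hρ).div_const _, hL,
    posDef_matrixExpectation hL (ae_of_all _ fun ω =>
      (posDef_latticeMatrix hPx hPs hρ (H ω)).inv)⟩

theorem capacityGap_le_add_logDet (hH : ∀ i j, Measurable fun ω => H ω i j)
    (hG : FiniteMatrixExpectation μ fun ω => gramMatrix (H ω)) (hρ : 0 ≤ snr M Px Pw) :
    capacityGap μ H Px Ps Pw ≤
      logDet (1 + (snr M Px Pw : ℂ) • matrixExpectation μ fun ω => gramMatrix (H ω)) +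
        logDet (latticeErrorMatrix μ H Px Ps Pw) := by
  have h1 := dirtFreeCapacity_le (Px := Px) (Pw := Pw) hH hG hρ
  have h2 : -logDet (latticeErrorMatrix μ H Px Ps Pw) ≤ latticeRate μ H Px Ps Pw :=
    le_max_left _ _
  rw [capacityGap]
  linarith

/-- Keeps only the nonnegativity of the rate, which is enough at low signal-to-noise ratio. -/
theorem capacityGap_le_logDet (hH : ∀ i j, Measurable fun ω => H ω i j)
    (hG : FiniteMatrixExpectation μ fun ω => gramMatrix (H ω)) (hρ : 0 ≤ snr M Px Pw) :
    capacityGap μ H Px Ps Pw ≤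
      logDet (1 + (snr M Px Pw : ℂ) • matrixExpectation μ fun ω => gramMatrix (H ω)) := by
  have h1 := dirtFreeCapacity_le (Px := Px) (Pw := Pw) hH hG hρ
  have h2 : 0 ≤ latticeRate μ H Px Ps Pw := le_max_right _ _
  rw [capacityGap]
  linarith

theorem capacityGap_lt_of_isUnit_gramMatrix (hM : 1 ≤ M) (hPx : 0 < Px) (hPs : 0 < Ps)
    (hρ : 1 ≤ snr M Px Pw) (hH : ∀ i j, Measurable fun ω => H ω i j)
    (hG : FiniteMatrixExpectation μ fun ω => gramMatrix (H ω))
    (hu : ∀ᵐ ω ∂μ, IsUnit (gramMatrix (H ω)))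
    (hinv : FiniteMatrixExpectation μ fun ω => (gramMatrix (H ω))⁻¹) :
    capacityGap μ H Px Ps Pw <
      logDet ((1 + matrixExpectation μ (fun ω => gramMatrix (H ω))) *
          matrixExpectation μ (fun ω => (gramMatrix (H ω))⁻¹)) := by
  have : Nonempty (Fin M) := ⟨⟨0, hM⟩⟩
  set ρ := snr M Px Pw with hρdef
  have hρ0 : 0 < ρ := one_pos.trans_le hρ
  have hρc : (0 : ℂ) < (ρ : ℂ) := by exact_mod_cast hρ0
  have hρc' : (0 : ℂ) < ((ρ : ℂ))⁻¹ := by exact_mod_cast inv_pos.mpr hρ0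
  have hln2 : 0 < Real.log 2 := Real.log_pos one_lt_two
  set E := matrixExpectation μ (fun ω => gramMatrix (H ω)) with hE
  set F := matrixExpectation μ (fun ω => (gramMatrix (H ω))⁻¹) with hF
  have hpd : ∀ᵐ ω ∂μ, (gramMatrix (H ω)).PosDef := hu.mono fun ω hω =>
    (posSemidef_gramMatrix (H ω)).posDef_iff_isUnit.mpr hω
  have hEps : E.PosSemidef :=
    posSemidef_matrixExpectation hG (ae_of_all _ fun ω => posSemidef_gramMatrix (H ω))
  have hFpd : F.PosDef := posDef_matrixExpectation hinv (hpd.mono fun ω hω => hω.inv)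
  have hL := finiteMatrixExpectation_latticeMatrix_inv (μ := μ) hPx hPs hρ0.le hH
  have hLpd : (latticeErrorMatrix μ H Px Ps Pw).PosDef :=
    (ratesWellDefined hPx hPs hρ0.le hH hG).2.2
  -- The only use of `ρ ≥ 1`: the difference of the two matrices is `(ρ - 1) I`.
  have hcap : logDet (1 + (ρ : ℂ) • E) ≤ logDet ((ρ : ℂ) • (1 + E)) := by
    refine div_le_div_of_nonneg_right (Matrix.PosDef.log_det_le_log_det
      (Matrix.PosDef.one.add_posSemidef (hEps.smul hρc.le)) ?_) hln2.le
    have : (ρ : ℂ) • (1 + E) - (1 + (ρ : ℂ) • E) = ((ρ - 1 : ℝ) : ℂ) • 1 := by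
      rw [smul_add, Complex.ofReal_sub, sub_smul, Complex.ofReal_one, one_smul]; abel
    rw [this]
    exact Matrix.PosSemidef.one.smul (by exact_mod_cast sub_nonneg.mpr hρ)
  -- The strict inequality of the theorem arises here, from the regularizer being positive.
  have hlat : logDet (latticeErrorMatrix μ H Px Ps Pw) < logDet ((ρ : ℂ)⁻¹ • F) := by
    refine div_lt_div_of_pos_right (hLpd.log_det_lt_log_det ?_) hln2
    rw [latticeErrorMatrix, hF, ← matrixExpectation_smul, ← matrixExpectation_sub (hinv.smul _) hL]
    refine posDef_matrixExpectation ((hinv.smul _).sub hL) (hpd.mono fun ω hω => ?_)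
    have h1 := (hω.smul hρc).inv_sub_inv_smul_one_add (regularizer_pos (M := M) hPx hPs)
    have h2 : ((ρ : ℂ) • gramMatrix (H ω))⁻¹ = (ρ : ℂ)⁻¹ • (gramMatrix (H ω))⁻¹ := by
      refine Matrix.inv_eq_left_inv ?_
      rw [smul_mul_smul_comm, inv_mul_cancel₀ hρc.ne', one_smul, Matrix.nonsing_inv_mul _
        ((Matrix.isUnit_iff_isUnit_det _).mp hω.isUnit)]
    rw [h2] at h1
    exact h1
  have hprod : logDet ((1 + E) * F) = logDet ((ρ : ℂ) • (1 + E)) + logDet ((ρ : ℂ)⁻¹ • F) := by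
    rw [← logDet_mul ((Matrix.PosDef.one.add_posSemidef hEps).smul hρc) (hFpd.smul hρc'),
      smul_mul_smul_comm, mul_inv_cancel₀ hρc.ne', one_smul]
  have := capacityGap_le_add_logDet (Px := Px) (Ps := Ps) (Pw := Pw) hH hG hρ0.le
  linarith

end Fading

/-! ### The standard complex Gaussian law and its unitary invariance -/

section ComplexGaussian

instance : IsProbabilityMeasure stdComplexGaussian :=
  Measure.isProbabilityMeasure_map (by fun_prop)

theorem charFun_stdComplexGaussian (t : ℂ) :
    charFun stdComplexGaussian t = Complex.exp (-(‖t‖ ^ 2 / 4 : ℝ)) := by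
  rw [charFun_apply, stdComplexGaussian, integral_map (by fun_prop) (by fun_prop)]
  have h1 : ∀ p : ℝ × ℝ, Complex.exp ((inner ℝ ((p.1 : ℂ) + (p.2 : ℂ) * Complex.I) t : ℝ) *
      Complex.I) = Complex.exp ((inner ℝ p.1 t.re : ℝ) * Complex.I) *
        Complex.exp ((inner ℝ p.2 t.im : ℝ) * Complex.I) := fun p => by
    rw [← Complex.exp_add, ← add_mul, ← Complex.ofReal_add]
    congr 3
    simp [Complex.inner]
  simp_rw [h1]
  rw [integral_prod_mul (fun x : ℝ => Complex.exp ((inner ℝ x t.re : ℝ) * Complex.I))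
    (fun x : ℝ => Complex.exp ((inner ℝ x t.im : ℝ) * Complex.I)), ← charFun_apply, ← charFun_apply,
    charFun_gaussianReal, charFun_gaussianReal, ← Complex.exp_add]
  congr 1
  rw [Complex.sq_norm, Complex.normSq_apply]
  push_cast
  ring

theorem integral_exp_neg_mul_sq_gaussianReal {t : ℝ} (ht : 0 ≤ t) :
    ∫ x, Real.exp (-t * x ^ 2) ∂gaussianReal 0 (1 / 2) = √(1 + t)⁻¹ := by
  rw [integral_gaussianReal_eq_integral_smul (by norm_num)]
  have h : ∀ x : ℝ, gaussianPDFReal 0 (1 / 2) x • Real.exp (-t * x ^ 2) =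
      (√Real.pi)⁻¹ * Real.exp (-(1 + t) * x ^ 2) := fun x => by
    rw [gaussianPDFReal, smul_eq_mul, mul_assoc, ← Real.exp_add]
    have h2 : ((1 / 2 : NNReal) : ℝ) = 1 / 2 := by norm_num
    rw [h2, show 2 * Real.pi * (1 / 2) = Real.pi by ring]
    congr 2
    ring
  simp_rw [h]
  rw [integral_const_mul, integral_gaussian, Real.sqrt_div Real.pi_pos.le, Real.sqrt_inv]
  have : √Real.pi ≠ 0 := (Real.sqrt_pos.mpr Real.pi_pos).ne'
  field_simp

/-- The Laplace transform of a unit exponential variable: each real coordinate contributes `√(1 +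
t)⁻¹`. -/
theorem integral_exp_neg_mul_sq_norm_stdComplexGaussian {t : ℝ} (ht : 0 ≤ t) :
    ∫ z, Real.exp (-t * ‖z‖ ^ 2) ∂stdComplexGaussian = (1 + t)⁻¹ := by
  rw [stdComplexGaussian, integral_map (by fun_prop) (by fun_prop)]
  have h1 : ∀ p : ℝ × ℝ, Real.exp (-t * ‖(p.1 : ℂ) + (p.2 : ℂ) * Complex.I‖ ^ 2) =
      Real.exp (-t * p.1 ^ 2) * Real.exp (-t * p.2 ^ 2) := fun p => by
    rw [← Real.exp_add, Complex.sq_norm, Complex.normSq_add_mul_I]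
    ring_nf
  simp_rw [h1]
  rw [integral_prod_mul (fun x : ℝ => Real.exp (-t * x ^ 2)) (fun x : ℝ => Real.exp (-t * x ^ 2)),
    integral_exp_neg_mul_sq_gaussianReal ht, Real.mul_self_sqrt (by positivity)]

theorem integrable_sq_gaussianReal : Integrable (fun x : ℝ => x ^ 2) (gaussianReal 0 (1 / 2)) :=
  (memLp_id_gaussianReal (μ := 0) (v := 1 / 2) 2).integrable_sq

theorem integral_sq_gaussianReal : ∫ x, x ^ 2 ∂gaussianReal 0 (1 / 2) = 1 / 2 := by
  have h := variance_id_gaussianReal (μ := 0) (v := 1 / 2)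
  rw [variance_of_integral_eq_zero (by fun_prop) (by simp [integral_id_gaussianReal])] at h
  simpa using h

theorem sq_norm_add_mul_I (p : ℝ × ℝ) :
    ‖(p.1 : ℂ) + (p.2 : ℂ) * Complex.I‖ ^ 2 = p.1 ^ 2 + p.2 ^ 2 := by
  rw [Complex.sq_norm, Complex.normSq_add_mul_I]

theorem integrable_sq_norm_stdComplexGaussian :
    Integrable (fun z : ℂ => ‖z‖ ^ 2) stdComplexGaussian := by
  rw [stdComplexGaussian, integrable_map_measure (by fun_prop) (by fun_prop)]
  simp only [Function.comp_def, sq_norm_add_mul_I]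
  exact (integrable_sq_gaussianReal.comp_fst _).add (integrable_sq_gaussianReal.comp_snd _)

theorem integral_sq_norm_stdComplexGaussian : ∫ z, ‖z‖ ^ 2 ∂stdComplexGaussian = 1 := by
  rw [stdComplexGaussian, integral_map (by fun_prop) (by fun_prop)]
  simp only [sq_norm_add_mul_I]
  rw [integral_add (integrable_sq_gaussianReal.comp_fst _) (integrable_sq_gaussianReal.comp_snd _),
    integral_fun_fst (fun x : ℝ => x ^ 2), integral_fun_snd (fun x : ℝ => x ^ 2),
    integral_sq_gaussianReal]
  norm_num

theorem real_inner_euclideanSpace_complex {ι : Type*} [Fintype ι] (x y : EuclideanSpace ℂ ι) :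
    (inner ℝ x y : ℝ) = (inner ℂ x y : ℂ).re := by
  simp [PiLp.inner_apply, Complex.inner]

theorem charFun_pi_stdComplexGaussian {ι : Type*} [Fintype ι] (t : EuclideanSpace ℂ ι) :
    charFun ((Measure.pi fun _ : ι => stdComplexGaussian).map (WithLp.toLp 2)) t =
      Complex.exp (-(‖t‖ ^ 2 / 4 : ℝ)) := by
  rw [charFun_pi]
  simp_rw [charFun_stdComplexGaussian]
  rw [← Complex.exp_sum, EuclideanSpace.norm_sq_eq]
  congr 1
  push_cast
  rw [Finset.sum_neg_distrib, Finset.sum_div]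

/-- The coordinates of a standard complex Gaussian vector along an orthonormal family are again
i.i.d. standard complex Gaussian. -/
theorem map_inner_pi_stdComplexGaussian {ι κ : Type*} [Fintype ι] [Fintype κ]
    {u : κ → EuclideanSpace ℂ ι} (hu : Orthonormal ℂ u) :
    (Measure.pi fun _ : ι => stdComplexGaussian).map
      (fun h l => (inner ℂ (u l) (WithLp.toLp 2 h) : ℂ)) =
      Measure.pi fun _ : κ => stdComplexGaussian := by
  have hm : Measurable fun (h : ι → ℂ) (l : κ) => (inner ℂ (u l) (WithLp.toLp 2 h) : ℂ) := by
    fun_prop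
  have : IsProbabilityMeasure ((Measure.pi fun _ : ι => stdComplexGaussian).map
      (fun h l => (inner ℂ (u l) (WithLp.toLp 2 h) : ℂ))) :=
    Measure.isProbabilityMeasure_map hm.aemeasurable
  refine charFun_eq_pi_iff.mp fun t => ?_
  -- The characteristic function of the coordinates at `t` is that of the whole vector at `∑ l, t l
  -- • u l`. It depends on the norm only, which orthonormality preserves.
  have hnorm : ‖∑ l, t l • u l‖ ^ 2 = ‖t‖ ^ 2 := by
    have h1 := hu.inner_sum t t Finset.univ
    rw [inner_self_eq_norm_sq_to_K] at h1
    rw [EuclideanSpace.norm_sq_eq t]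
    have h2 : ((‖∑ l, t l • u l‖ ^ 2 : ℝ) : ℂ) = ((∑ l, ‖t l‖ ^ 2 : ℝ) : ℂ) := by
      push_cast
      refine h1.trans (Finset.sum_congr rfl fun l _ => ?_)
      exact Complex.conj_mul' _
    exact_mod_cast h2
  rw [← charFun_pi, charFun_pi_stdComplexGaussian, ← hnorm, ← charFun_pi_stdComplexGaussian,
    charFun_apply, charFun_apply, integral_map (by fun_prop) (by fun_prop),
    integral_map hm.aemeasurable (by fun_prop), integral_map (by fun_prop) (by fun_prop)]
  congr 1
  ext h
  congr 3
  rw [real_inner_euclideanSpace_complex, real_inner_euclideanSpace_complex, PiLp.inner_apply,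
    inner_sum]
  congr 1
  refine Finset.sum_congr rfl fun l _ => ?_
  rw [inner_smul_right, RCLike.inner_apply, inner_conj_symm]

end ComplexGaussian

/-! ### Reciprocal moments of squared norms and distances -/

section InverseMoment

/-- Turns a reciprocal moment into an integral of Laplace transforms. In `ENNReal` it holds at `q =
0` too, both sides being infinite. -/
theorem lintegral_Ioi_exp_neg_mul {q : ℝ} (hq : 0 ≤ q) :
    ∫⁻ t in Set.Ioi (0 : ℝ), ENNReal.ofReal (Real.exp (-t * q)) = (ENNReal.ofReal q)⁻¹ := by
  rcases hq.eq_or_lt with rfl | hq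
  · simp
  · have h1 : (fun t : ℝ => Real.exp (-t * q)) = fun t => Real.exp (-q * t) := by
      ext t; ring_nf
    rw [← ofReal_integral_eq_lintegral_ofReal, h1, integral_exp_mul_Ioi (neg_neg_of_pos hq)]
    · simp [ENNReal.ofReal_inv_of_pos hq]
    · rw [h1]
      exact integrableOn_exp_mul_Ioi (neg_neg_of_pos hq) 0
    · exact ae_of_all _ fun t => (Real.exp_pos _).le

theorem lintegral_Ioi_inv_one_add_pow (m : ℕ) :
    ∫⁻ t in Set.Ioi (0 : ℝ), ENNReal.ofReal ((1 + t)⁻¹ ^ (m + 2)) =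
      ENNReal.ofReal (1 / (m + 1)) := by
  have hm : (m + 1 : ℝ) ≠ 0 := by positivity
  have hderiv : ∀ x ∈ Set.Ici (0 : ℝ),
      HasDerivAt (fun t : ℝ => -(1 / (m + 1)) * (1 + t)⁻¹ ^ (m + 1))
      ((1 + x)⁻¹ ^ (m + 2)) x := fun x hx => by
    have hx' : 1 + x ≠ 0 := by have : (0 : ℝ) ≤ x := hx; positivity
    have h := ((((hasDerivAt_id x).const_add 1).inv hx').pow (m + 1)).const_mul (-(1 / (m + 1 : ℝ)))
    refine h.congr_deriv ?_
    simp only [id, Nat.add_sub_cancel, Nat.cast_add, Nat.cast_one, Pi.inv_apply]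
    rw [pow_succ (1 + x)⁻¹ (m + 1), pow_succ (1 + x)⁻¹ m]
    field_simp
  have hpos : ∀ x ∈ Set.Ioi (0 : ℝ), 0 ≤ (1 + x)⁻¹ ^ (m + 2) := fun x hx => by
    have : (0 : ℝ) < x := hx
    positivity
  have hlim : Filter.Tendsto (fun t : ℝ => -(1 / (m + 1 : ℝ)) * (1 + t)⁻¹ ^ (m + 1))
      Filter.atTop (nhds 0) := by
    have h1 : Filter.Tendsto (fun t : ℝ => (1 + t)⁻¹) Filter.atTop (nhds 0) :=
      tendsto_inv_atTop_zero.comp (Filter.tendsto_atTop_add_const_left _ _ Filter.tendsto_id)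
    simpa using (h1.pow (m + 1)).const_mul (-(1 / (m + 1 : ℝ)))
  rw [← ofReal_integral_eq_lintegral_ofReal (integrableOn_Ioi_deriv_of_nonneg' hderiv hpos hlim)
    (ae_restrict_of_forall_mem measurableSet_Ioi hpos),
    integral_Ioi_of_hasDerivAt_of_nonneg' hderiv hpos hlim]
  simp

theorem lintegral_pi_exp_neg_mul_sum_sq_norm (k : ℕ) {t : ℝ} (ht : 0 ≤ t) :
    ∫⁻ z, ENNReal.ofReal (Real.exp (-t * ∑ l, ‖z l‖ ^ 2))
      ∂(Measure.pi fun _ : Fin k => stdComplexGaussian) = ENNReal.ofReal ((1 + t)⁻¹ ^ k) := by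
  rw [← ofReal_integral_eq_lintegral_ofReal]
  · simp_rw [Finset.mul_sum, Real.exp_sum]
    rw [integral_fintype_prod_eq_pow (fun z : ℂ => Real.exp (-t * ‖z‖ ^ 2)),
      integral_exp_neg_mul_sq_norm_stdComplexGaussian ht, Fintype.card_fin]
  · refine Integrable.of_bound (by fun_prop : Measurable _).aestronglyMeasurable 1
      (ae_of_all _ fun z => ?_)
    rw [Real.norm_of_nonneg (Real.exp_pos _).le, Real.exp_le_one_iff, neg_mul, neg_nonpos]
    positivity
  · exact ae_of_all _ fun t => (Real.exp_pos _).le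

/-- The mean of the reciprocal of a `Gamma(m + 2)` variable, written as a squared norm. -/
theorem lintegral_pi_inv_sum_sq_norm (m : ℕ) :
    ∫⁻ z, (ENNReal.ofReal (∑ l, ‖z l‖ ^ 2))⁻¹
      ∂(Measure.pi fun _ : Fin (m + 2) => stdComplexGaussian) = ENNReal.ofReal (1 / (m + 1)) := by
  have h : ∀ z : Fin (m + 2) → ℂ, (ENNReal.ofReal (∑ l, ‖z l‖ ^ 2))⁻¹ =
      ∫⁻ t in Set.Ioi (0 : ℝ), ENNReal.ofReal (Real.exp (-t * ∑ l, ‖z l‖ ^ 2)) := fun z =>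
    (lintegral_Ioi_exp_neg_mul (by positivity)).symm
  simp_rw [h]
  rw [lintegral_lintegral_swap (by fun_prop), ← lintegral_Ioi_inv_one_add_pow]
  exact setLIntegral_congr_fun measurableSet_Ioi fun t ht =>
    lintegral_pi_exp_neg_mul_sum_sq_norm _ (le_of_lt ht)

/-- Mean of the reciprocal squared distance of a standard complex Gaussian vector to a subspace. -/
theorem lintegral_inv_iInf_dist_le {N m : ℕ} {κ : Type*}
    (W : Submodule ℂ (EuclideanSpace ℂ (Fin N))) (hW : Module.finrank ℂ W + (m + 2) ≤ N)
    {w : κ → EuclideanSpace ℂ (Fin N)} (hw : ∀ c, w c ∈ W) :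
    ∫⁻ h, (⨅ c, ENNReal.ofReal (‖WithLp.toLp 2 h - w c‖ ^ 2))⁻¹
      ∂(Measure.pi fun _ : Fin N => stdComplexGaussian) ≤ ENNReal.ofReal (1 / (m + 1)) := by
  -- Only `m + 2` orthonormal directions in the complement are kept, even if there are more.
  have hdim : m + 2 ≤ Module.finrank ℂ Wᗮ := by
    have := Submodule.finrank_add_finrank_orthogonal W
    rw [finrank_euclideanSpace_fin] at this
    omega
  set b := stdOrthonormalBasis ℂ Wᗮ
  set u : Fin (m + 2) → EuclideanSpace ℂ (Fin N) := fun l => (b (Fin.castLE hdim l) : _) with hu'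
  have hu : Orthonormal ℂ u :=
    (b.orthonormal.comp_linearIsometry Wᗮ.subtypeₗᵢ).comp _ (Fin.castLE_injective hdim)
  rw [← lintegral_pi_inv_sum_sq_norm, ← map_inner_pi_stdComplexGaussian hu,
    lintegral_map (by fun_prop) (by fun_prop)]
  -- Coordinates orthogonal to `W` do not see `w c`, so Bessel's inequality bounds every distance
  -- below by the same sum of squares.
  refine lintegral_mono fun h => ENNReal.inv_le_inv.mpr
    (le_iInf fun c => ENNReal.ofReal_le_ofReal ?_)
  have h1 : ∀ l, (inner ℂ (u l) (WithLp.toLp 2 h) : ℂ) = inner ℂ (u l) (WithLp.toLp 2 h - w c) :=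
    fun l => by
      rw [inner_sub_right, Submodule.inner_left_of_mem_orthogonal (hw c) (b _).2, sub_zero]
  simp_rw [h1]
  exact hu.sum_inner_products_le _

end InverseMoment

/-! ### Distance of a column to the others, and the inverse Gram matrix -/

section ColumnDistance

variable {N M : ℕ}

/-- Squared distance of the vector `h` to the span of the columns of the array `Y`. -/
noncomputable def sqDistToColumns (h : Fin N → ℂ) (Y : Fin N × Fin M → ℂ) : ENNReal :=
  ⨅ c : Fin M → ℂ, ENNReal.ofReal (∑ k, ‖h k - ∑ i, c i * Y (k, i)‖ ^ 2)

/-- The infimum is uncountable, but an infimum of continuous functions is upper semicontinuous. -/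
theorem measurable_sqDistToColumns :
    Measurable fun p : (Fin N → ℂ) × (Fin N × Fin M → ℂ) => sqDistToColumns p.1 p.2 := by
  refine UpperSemicontinuous.measurable (upperSemicontinuous_iInf fun c =>
    (ENNReal.continuous_ofReal.comp ?_).upperSemicontinuous)
  fun_prop

/-- The array `H` with its `j`-th column replaced by zero. -/
def eraseColumn (j : Fin M) (H : Matrix (Fin N) (Fin M) ℂ) : Fin N × Fin M → ℂ :=
  fun p => if p.2 = j then 0 else H p.1 p.2

theorem measurable_eraseColumn {Ω : Type*} [MeasurableSpace Ω] {H : Ω → Matrix (Fin N) (Fin M) ℂ}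
    (hH : ∀ i j, Measurable fun ω => H ω i j) (j : Fin M) :
    Measurable fun ω => eraseColumn j (H ω) := by
  refine measurable_pi_lambda _ fun p => ?_
  by_cases hp : p.2 = j
  · simp [eraseColumn, hp]
  · simpa [eraseColumn, hp] using hH p.1 p.2

theorem lintegral_inv_sqDistToColumns_le {j : Fin M} {m : ℕ} (hN : N = M + m + 1)
    {Y : Fin N × Fin M → ℂ} (hY : ∀ k, Y (k, j) = 0) :
    ∫⁻ h, (sqDistToColumns h Y)⁻¹ ∂(Measure.pi fun _ : Fin N => stdComplexGaussian) ≤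
      ENNReal.ofReal (1 / (m + 1)) := by
  classical
  set v : Fin M → EuclideanSpace ℂ (Fin N) := fun i => WithLp.toLp 2 fun k => Y (k, i) with hv
  set s : Finset (EuclideanSpace ℂ (Fin N)) := (Finset.univ.erase j).image v
  -- The vanishing column `j` is left out of the spanning set. This gains one dimension: `(M - 1) +
  -- (m + 2) = N`.
  have hs : s.card ≤ M - 1 := by
    refine Finset.card_image_le.trans ?_
    simp
  have hW : Module.finrank ℂ (Submodule.span ℂ (s : Set (EuclideanSpace ℂ (Fin N)))) + (m + 2) ≤
      N := by
    have := finrank_span_finset_le_card (R := ℂ) s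
    have := j.pos
    rw [Set.finrank] at *
    omega
  have hw : ∀ c : Fin M → ℂ, ∑ i, c i • v i ∈
      Submodule.span ℂ (s : Set (EuclideanSpace ℂ (Fin N))) := fun c =>
    Submodule.sum_mem _ fun i _ => by
      by_cases hi : i = j
      · have : v i = 0 := by
          ext k
          simp [hv, hi, hY]
        rw [this, smul_zero]
        exact Submodule.zero_mem _
      · exact Submodule.smul_mem _ _ (Submodule.subset_span
          (Finset.mem_coe.mpr (Finset.mem_image_of_mem v (by simp [hi]))))
  refine le_of_eq_of_le ?_ (lintegral_inv_iInf_dist_le _ hW hw)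
  simp_rw [EuclideanSpace.norm_sq_eq]
  simp [sqDistToColumns, hv]

/-- Dividing `H x` by `x j` gives column `j` plus a combination of the others, so `-(x i / x j)` are
admissible coefficients. -/
theorem sqDistToColumns_eraseColumn_le (H : Matrix (Fin N) (Fin M) ℂ) {j : Fin M} {x : Fin M → ℂ}
    (hx : x j ≠ 0) :
    sqDistToColumns (fun k => H k j) (eraseColumn j H) ≤
      ENNReal.ofReal ((∑ k, ‖(H *ᵥ x) k‖ ^ 2) / ‖x j‖ ^ 2) := by
  refine iInf_le_of_le (fun i => -(x i / x j)) (le_of_eq ?_)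
  congr 1
  rw [Finset.sum_div]
  refine Finset.sum_congr rfl fun k _ => ?_
  rw [← div_pow, ← norm_div]
  congr 2
  have h1 : ∑ i, -(x i / x j) * eraseColumn j H (k, i) =
      -((∑ i ∈ Finset.univ.erase j, H k i * x i) / x j) := by
    rw [Finset.sum_div, ← Finset.sum_neg_distrib, ← Finset.add_sum_erase _ _ (Finset.mem_univ j)]
    simp only [eraseColumn, if_true, mul_zero, zero_add]
    refine Finset.sum_congr rfl fun i hi => ?_
    rw [if_neg (Finset.ne_of_mem_erase hi)]
    ring
  have h2 : (H *ᵥ x) k = H k j * x j + ∑ i ∈ Finset.univ.erase j, H k i * x i := by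
    rw [Finset.add_sum_erase _ (fun i => H k i * x i) (Finset.mem_univ j)]
    rfl
  rw [h1, h2]
  field_simp
  ring

theorem sum_sq_norm_mulVec (H : Matrix (Fin N) (Fin M) ℂ) (x : Fin M → ℂ) :
    ((∑ k, ‖(H *ᵥ x) k‖ ^ 2 : ℝ) : ℂ) = star x ⬝ᵥ gramMatrix H *ᵥ x := by
  rw [gramMatrix, ← Matrix.mulVec_mulVec, Matrix.dotProduct_mulVec, ← Matrix.star_mulVec]
  simp [dotProduct, Complex.conj_mul']

theorem isUnit_gramMatrix_of_sqDist_ne_zero (H : Matrix (Fin N) (Fin M) ℂ)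
    (h : ∀ j, sqDistToColumns (fun k => H k j) (eraseColumn j H) ≠ 0) :
    IsUnit (gramMatrix H) := by
  rw [← Matrix.mulVec_injective_iff_isUnit, ← Matrix.coe_mulVecLin, injective_iff_map_eq_zero]
  intro x hx
  rw [Matrix.mulVecLin_apply] at hx
  by_contra hne
  obtain ⟨j, hj⟩ := Function.ne_iff.mp hne
  refine h j (le_antisymm ?_ zero_le)
  have h1 := sum_sq_norm_mulVec H x
  rw [hx, dotProduct_zero] at h1
  have h2 : ∑ k, ‖(H *ᵥ x) k‖ ^ 2 = 0 := by exact_mod_cast h1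
  simpa [h2] using sqDistToColumns_eraseColumn_le H hj

/-- For `x = G⁻¹ e_j`, `‖H x‖² = x* G x = x j`, which is real and positive. Hence the squared
distance is at most `‖H x‖² / |x j|² = 1 / x j`, and `x j` is the diagonal entry. -/
theorem inv_gramMatrix_diag_le (H : Matrix (Fin N) (Fin M) ℂ) (hu : IsUnit (gramMatrix H))
    (j : Fin M) :
    ENNReal.ofReal ((gramMatrix H)⁻¹ j j).re ≤
      (sqDistToColumns (fun k => H k j) (eraseColumn j H))⁻¹ := by
  have hpd := ((posSemidef_gramMatrix H).posDef_iff_isUnit.mpr hu).inv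
  set x : Fin M → ℂ := (gramMatrix H)⁻¹ *ᵥ Pi.single j 1 with hx
  have hxj : x j = (gramMatrix H)⁻¹ j j := by simp [hx]
  have hpos : 0 < x j := hxj ▸ hpd.diag_pos
  obtain ⟨hre, him⟩ := Complex.lt_def.mp hpos
  have hxr : x j = ((x j).re : ℂ) := Complex.ext rfl (by simpa using him.symm)
  have hGx : gramMatrix H *ᵥ x = Pi.single j 1 := by
    rw [hx, Matrix.mulVec_mulVec, Matrix.mul_nonsing_inv _
      ((Matrix.isUnit_iff_isUnit_det _).mp hu), Matrix.one_mulVec]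
  have hsum : ∑ k, ‖(H *ᵥ x) k‖ ^ 2 = (x j).re := by
    have h1 := sum_sq_norm_mulVec H x
    rw [hGx, dotProduct_single, mul_one, Pi.star_apply, hxr, Complex.star_def,
      Complex.conj_ofReal] at h1
    exact_mod_cast h1
  have h := sqDistToColumns_eraseColumn_le H hpos.ne'
  have hnorm : ‖x j‖ = (x j).re := by
    rw [hxr, Complex.norm_real, Real.norm_of_nonneg hre.le, Complex.ofReal_re]
  rw [hsum, hnorm] at h
  rw [← hxj, ENNReal.le_inv_iff_le_inv]
  refine h.trans (le_of_eq ?_)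
  rw [← ENNReal.ofReal_inv_of_pos hre]
  congr 1
  field_simp

end ColumnDistance

/-! ### I.i.d. Rayleigh fading -/

section IIDRayleigh

variable {Ω : Type*} [MeasurableSpace Ω] {μ : Measure Ω} {N M : ℕ}
  {H : Ω → Matrix (Fin N) (Fin M) ℂ}

theorem map_column_of_isIIDRayleigh [IsProbabilityMeasure μ]
    (hH : ∀ i j, Measurable fun ω => H ω i j) (hiid : IsIIDRayleigh μ H) (j : Fin M) :
    μ.map (fun ω k => H ω k j) = Measure.pi fun _ : Fin N => stdComplexGaussian := by
  have h1 : iIndepFun (fun (k : Fin N) ω => H ω k j) μ :=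
    hiid.1.precomp (g := fun k : Fin N => (k, j)) (fun a b hab => (Prod.mk.inj hab).1)
  rw [(iIndepFun_iff_map_fun_eq_pi_map fun k => (hH k j).aemeasurable).mp h1]
  simp_rw [hiid.2]

theorem indepFun_column_eraseColumn (hH : ∀ i j, Measurable fun ω => H ω i j)
    (hiid : IsIIDRayleigh μ H) (j : Fin M) :
    IndepFun (fun ω k => H ω k j) (fun ω => eraseColumn j (H ω)) μ := by
  classical
  set S : Finset (Fin N × Fin M) := Finset.univ.filter fun p => p.2 = j
  set T : Finset (Fin N × Fin M) := Finset.univ.filter fun p => p.2 ≠ j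
  have hST : Disjoint S T := Finset.disjoint_filter_filter_not _ _ _
  have h := hiid.1.indepFun_finset S T hST fun p => hH p.1 p.2
  refine h.comp (φ := fun f k => f ⟨(k, j), by simp [S]⟩)
    (ψ := fun f p => if hp : p.2 = j then 0 else f ⟨p, by simp [T, hp]⟩) ?_ ?_ |>.congr ?_ ?_
  · fun_prop
  · refine measurable_pi_lambda _ fun p => ?_
    by_cases hp : p.2 = j
    · simp only [hp, dite_true]; fun_prop
    · simp only [hp, dite_false]; fun_prop
  · exact Filter.EventuallyEq.rfl
  · refine ae_of_all _ fun ω => ?_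
    ext p
    by_cases hp : p.2 = j <;> simp [eraseColumn, hp]

/-- Column `j` is independent of the others, so these may be frozen by Tonelli; the bound for a
fixed subspace is uniform in them. -/
theorem lintegral_inv_sqDist_column_le [IsProbabilityMeasure μ] {m : ℕ} (hN : N = M + m + 1)
    (hH : ∀ i j, Measurable fun ω => H ω i j) (hiid : IsIIDRayleigh μ H) (j : Fin M) :
    ∫⁻ ω, (sqDistToColumns (fun k => H ω k j) (eraseColumn j (H ω)))⁻¹ ∂μ ≤
      ENNReal.ofReal (1 / (m + 1)) := by
  have hX : Measurable fun ω k => H ω k j := measurable_pi_lambda _ fun k => hH k j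
  have hY := measurable_eraseColumn hH j
  have hF : Measurable fun p : (Fin N → ℂ) × (Fin N × Fin M → ℂ) =>
      (sqDistToColumns p.1 p.2)⁻¹ := measurable_sqDistToColumns.inv
  have hYprob : IsProbabilityMeasure (μ.map fun ω => eraseColumn j (H ω)) :=
    Measure.isProbabilityMeasure_map hY.aemeasurable
  have h1 := (indepFun_iff_map_prod_eq_prod_map_map hX.aemeasurable hY.aemeasurable).mp
    (indepFun_column_eraseColumn hH hiid j)
  have h2 : ∫⁻ ω, (sqDistToColumns (fun k => H ω k j) (eraseColumn j (H ω)))⁻¹ ∂μ =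
      ∫⁻ p, (sqDistToColumns p.1 p.2)⁻¹ ∂(μ.map fun ω => (fun k => H ω k j, eraseColumn j (H ω))) :=
    (lintegral_map hF (hX.prodMk hY)).symm
  rw [h2, h1, map_column_of_isIIDRayleigh hH hiid, lintegral_prod_symm _ hF.aemeasurable,
    lintegral_map (by exact hF.lintegral_prod_left') hY]
  calc _ ≤ ∫⁻ _, ENNReal.ofReal (1 / (m + 1)) ∂μ := lintegral_mono fun ω =>
        lintegral_inv_sqDistToColumns_le (j := j) hN (fun k => by simp)
    _ = _ := by simp

/-- A reciprocal with finite mean is almost surely finite, so no column lies in the span of the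
others. -/
theorem ae_isUnit_gramMatrix_of_isIIDRayleigh [IsProbabilityMeasure μ] (hNM : M < N)
    (hH : ∀ i j, Measurable fun ω => H ω i j) (hiid : IsIIDRayleigh μ H) :
    ∀ᵐ ω ∂μ, IsUnit (gramMatrix (H ω)) := by
  obtain ⟨m, hm⟩ := Nat.exists_eq_add_of_lt hNM
  have h : ∀ j, ∀ᵐ ω ∂μ, sqDistToColumns (fun k => H ω k j) (eraseColumn j (H ω)) ≠ 0 := fun j => by
    have hfin := (lintegral_inv_sqDist_column_le hm hH hiid j).trans_lt ENNReal.ofReal_lt_top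
    have hm' : Measurable fun ω =>
        (sqDistToColumns (fun k => H ω k j) (eraseColumn j (H ω)))⁻¹ := by
      exact (measurable_sqDistToColumns.comp ((measurable_pi_lambda _ fun k => hH k j).prodMk
        (measurable_eraseColumn hH j))).inv
    filter_upwards [ae_lt_top hm' hfin.ne] with ω hω h0
    simp [h0] at hω
  filter_upwards [ae_all_iff.mpr h] with ω hω
  exact isUnit_gramMatrix_of_sqDist_ne_zero _ hω

theorem inv_gramMatrix_diag_integrable_and_le [IsProbabilityMeasure μ] (hNM : M < N)
    (hH : ∀ i j, Measurable fun ω => H ω i j) (hiid : IsIIDRayleigh μ H) (j : Fin M) :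
    Integrable (fun ω => ((gramMatrix (H ω))⁻¹ j j).re) μ ∧
      ∫ ω, ((gramMatrix (H ω))⁻¹ j j).re ∂μ ≤ 1 / ((N : ℝ) - M) := by
  obtain ⟨m, hm⟩ := Nat.exists_eq_add_of_lt hNM
  have hmeas : Measurable fun ω => ((gramMatrix (H ω))⁻¹ j j).re :=
    Complex.measurable_re.comp (measurable_matrix_inv (measurable_gramMatrix hH) j j)
  have hnn : ∀ ω, 0 ≤ ((gramMatrix (H ω))⁻¹ j j).re := fun ω =>
    (Complex.le_def.mp (posSemidef_gramMatrix (H ω)).inv.diag_nonneg).1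
  have hle : ∫⁻ ω, ENNReal.ofReal ((gramMatrix (H ω))⁻¹ j j).re ∂μ ≤
      ENNReal.ofReal (1 / (m + 1)) :=
    (lintegral_mono_ae ((ae_isUnit_gramMatrix_of_isIIDRayleigh hNM hH hiid).mono fun ω hω =>
      inv_gramMatrix_diag_le (H ω) hω j)).trans (lintegral_inv_sqDist_column_le hm hH hiid j)
  have hNr : (N : ℝ) - M = m + 1 := by rw [hm]; push_cast; ring
  refine ⟨⟨hmeas.aestronglyMeasurable, ?_⟩, ?_⟩
  · rw [hasFiniteIntegral_iff_ofReal (ae_of_all _ hnn)]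
    exact hle.trans_lt ENNReal.ofReal_lt_top
  · rw [integral_eq_lintegral_of_nonneg_ae (ae_of_all _ hnn) hmeas.aestronglyMeasurable, hNr]
    exact ENNReal.toReal_le_of_le_ofReal (by positivity) hle

theorem trace_gramMatrix {N M : ℕ} (H : Matrix (Fin N) (Fin M) ℂ) :
    (gramMatrix H).trace.re = ∑ j, ∑ k, ‖H k j‖ ^ 2 := by
  have : (gramMatrix H).trace = ((∑ j, ∑ k, ‖H k j‖ ^ 2 : ℝ) : ℂ) := by
    simp [gramMatrix, Matrix.trace, Matrix.mul_apply, Complex.conj_mul']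
  rw [this, Complex.ofReal_re]

theorem finiteMatrixExpectation_gramMatrix (hH : ∀ i j, Measurable fun ω => H ω i j)
    (h2 : ∀ i j, Integrable (fun ω => ‖H ω i j‖ ^ 2) μ) :
    FiniteMatrixExpectation μ fun ω => gramMatrix (H ω) := by
  refine finiteMatrixExpectation_of_trace_le
    (fun i j => (measurable_gramMatrix hH i j).aestronglyMeasurable)
    (g := fun ω => ∑ j, ∑ k, ‖H ω k j‖ ^ 2)
    (integrable_finsetSum _ fun j _ => integrable_finsetSum _ fun k _ => h2 k j)
    (ae_of_all _ fun ω => ⟨posSemidef_gramMatrix _, (trace_gramMatrix _).le⟩)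

theorem capacityGap_lt_of_isIIDRayleigh [IsProbabilityMeasure μ] {Px Ps Pw : ℝ} (hM : 1 ≤ M)
    (hNM : M < N) (hPx : 0 < Px) (hPs : 0 < Ps) (hρ : 1 ≤ snr M Px Pw)
    (hH : ∀ i j, Measurable fun ω => H ω i j)
    (hiid : IsIIDRayleigh μ H) :
    RatesWellDefined μ H Px Ps Pw ∧
      capacityGap μ H Px Ps Pw < M * Real.logb 2 (1 + ((M : ℝ) + 1) / ((N : ℝ) - (M : ℝ))) := by
  have hln2 : 0 < Real.log 2 := Real.log_pos one_lt_two
  have hNM' : (0 : ℝ) < (N : ℝ) - M := by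
    rw [sub_pos]; exact_mod_cast hNM
  have h2 : ∀ i j, Integrable (fun ω => ‖H ω i j‖ ^ 2) μ := fun i j =>
    (integrable_map_measure (g := fun z : ℂ => ‖z‖ ^ 2) (by fun_prop) (hH i j).aemeasurable).mp
      ((hiid.2 i j).symm ▸ integrable_sq_norm_stdComplexGaussian)
  have h2v : ∀ i j, ∫ ω, ‖H ω i j‖ ^ 2 ∂μ = 1 := fun i j => by
    rw [← integral_sq_norm_stdComplexGaussian, ← hiid.2 i j,
      integral_map (hH i j).aemeasurable (by fun_prop)]
  have hG := finiteMatrixExpectation_gramMatrix hH h2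
  have hu := ae_isUnit_gramMatrix_of_isIIDRayleigh hNM hH hiid
  have hd := inv_gramMatrix_diag_integrable_and_le hNM hH hiid
  have htr : ∀ ω, ((gramMatrix (H ω))⁻¹).trace.re = ∑ j, ((gramMatrix (H ω))⁻¹ j j).re :=
    fun ω => by simp [Matrix.trace]
  have hinv : FiniteMatrixExpectation μ fun ω => (gramMatrix (H ω))⁻¹ :=
    finiteMatrixExpectation_of_trace_le
      (fun i j => (measurable_matrix_inv (measurable_gramMatrix hH) i j).aestronglyMeasurable)
      (integrable_finsetSum _ fun j _ => (hd j).1)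
      (ae_of_all _ fun ω => ⟨(posSemidef_gramMatrix _).inv, (htr ω).le⟩)
  refine ⟨ratesWellDefined hPx hPs (zero_le_one.trans hρ) hH hG, ?_⟩
  refine (capacityGap_lt_of_isUnit_gramMatrix hM hPx hPs hρ hH hG hu hinv).trans_le ?_
  have hEps := posSemidef_matrixExpectation hG (ae_of_all _ fun ω => posSemidef_gramMatrix (H ω))
  have hEpd := Matrix.PosDef.one.add_posSemidef hEps
  have hFpd := posDef_matrixExpectation hinv (hu.mono fun ω hω =>
    ((posSemidef_gramMatrix (H ω)).posDef_iff_isUnit.mpr hω).inv)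
  -- The trace of `I + E[G]` is `M + N M = M (N + 1)`.
  have hE := hEpd.log_det_le_of_trace_le (t := N + 1) (by positivity) (by
    have h := trace_mul_matrixExpectation hG 1
    simp only [one_mul, trace_gramMatrix] at h
    rw [integral_finsetSum _ fun j _ => integrable_finsetSum _ fun k _ => h2 k j] at h
    simp_rw [integral_finsetSum _ fun k _ => h2 k _, h2v] at h
    rw [Matrix.trace_add, Complex.add_re, h]
    simp
    linarith)
  have hF := hFpd.log_det_le_of_trace_le (t := 1 / ((N : ℝ) - M)) (by positivity) (by
    have h := trace_mul_matrixExpectation hinv 1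
    simp only [one_mul, htr] at h
    rw [h, integral_finsetSum _ fun j _ => (hd j).1]
    exact (Finset.sum_le_card_nsmul _ _ _ fun j _ => (hd j).2).trans_eq (by simp))
  rw [logDet_mul hEpd hFpd, logDet_eq_log_div, logDet_eq_log_div, ← add_div]
  have hlog : Real.log (1 + ((M : ℝ) + 1) / ((N : ℝ) - (M : ℝ))) =
      Real.log (N + 1) + Real.log (1 / ((N : ℝ) - M)) := by
    rw [← Real.log_mul (by positivity) (by positivity)]
    congr 1
    field_simp
    ring
  rw [Real.logb, hlog, ← mul_div_assoc, mul_add]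
  rw [Fintype.card_fin] at hE hF
  exact div_le_div_of_nonneg_right (add_le_add hE hF) hln2.le

end IIDRayleigh

/-! ### Moments of the Nakagami and Rayleigh laws -/

section Nakagami

theorem nakagamiMeasure_eq_withDensity {m θ : ℝ} (hm : 0 < m) (hθ : 0 < θ) :
    nakagamiMeasure m θ = (volume.restrict (Set.Ioi 0)).withDensity fun x => ENNReal.ofReal
      (2 * (m / θ) ^ m / Real.Gamma m * (x ^ (2 * m - 1) * Real.exp (-(m / θ) * x ^ 2))) := by
  rw [nakagamiMeasure]
  congr 1
  ext x
  rw [Real.div_rpow hm.le hθ.le]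
  congr 1
  have := (Real.rpow_pos_of_pos hθ m).ne'
  have := (Real.Gamma_pos_of_pos hm).ne'
  field_simp

theorem rayleighMeasure_eq_nakagamiMeasure {σ : ℝ} (hσ : 0 < σ) :
    rayleighMeasure σ = nakagamiMeasure 1 (2 * σ ^ 2) := by
  rw [rayleighMeasure, nakagamiMeasure]
  congr 1
  ext x
  congr 1
  rw [Real.Gamma_one, Real.rpow_one, Real.rpow_one, show (2 * 1 - 1 : ℝ) = 1 by norm_num,
    Real.rpow_one]
  congr 1
  · field_simp
  · congr 1
    field_simp

theorem ae_nakagamiMeasure_pos (m θ : ℝ) : ∀ᵐ x ∂nakagamiMeasure m θ, 0 < x :=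
  (withDensity_absolutelyContinuous _ _).ae_le (ae_restrict_mem measurableSet_Ioi)

section Density

variable {m θ : ℝ} (hm : 0 < m) (hθ : 0 < θ)
include hm hθ

theorem nakagami_density_smul_ae_eq (f : ℝ → ℝ) :
    (fun x => (ENNReal.ofReal (2 * (m / θ) ^ m / Real.Gamma m *
      (x ^ (2 * m - 1) * Real.exp (-(m / θ) * x ^ 2)))).toReal • f x)
      =ᵐ[volume.restrict (Set.Ioi 0)] fun x => 2 * (m / θ) ^ m / Real.Gamma m *
        (x ^ (2 * m - 1) * Real.exp (-(m / θ) * x ^ 2) * f x) := by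
  filter_upwards [ae_restrict_mem measurableSet_Ioi] with x hx
  have hx' : 0 < x := hx
  have := Real.Gamma_pos_of_pos hm
  rw [ENNReal.toReal_ofReal (by positivity), smul_eq_mul, mul_assoc]

theorem integral_nakagamiMeasure (f : ℝ → ℝ) :
    ∫ x, f x ∂nakagamiMeasure m θ = 2 * (m / θ) ^ m / Real.Gamma m *
      ∫ x in Set.Ioi 0, x ^ (2 * m - 1) * Real.exp (-(m / θ) * x ^ 2) * f x := by
  rw [nakagamiMeasure_eq_withDensity hm hθ,
    integral_withDensity_eq_integral_toReal_smul (by fun_prop) (by simp),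
    integral_congr_ae (nakagami_density_smul_ae_eq hm hθ f), integral_const_mul]

theorem integrable_rpow_nakagamiMeasure {s : ℝ} (hs : 0 < m + s / 2) :
    Integrable (fun x => x ^ s) (nakagamiMeasure m θ) := by
  rw [nakagamiMeasure_eq_withDensity hm hθ,
    integrable_withDensity_iff_integrable_smul' (by fun_prop) (by simp),
    integrable_congr (nakagami_density_smul_ae_eq hm hθ _)]
  refine Integrable.const_mul ?_ _
  refine (integrableOn_rpow_mul_exp_neg_mul_sq (b := m / θ) (by positivity)
    (s := 2 * m - 1 + s) (by linarith)).congr_fun (fun x hx => ?_) measurableSet_Ioi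
  have hx' : 0 < x := hx
  simp only [Real.rpow_add hx']
  ring

theorem integral_rpow_nakagamiMeasure {s : ℝ} (hs : 0 < m + s / 2) :
    ∫ x, x ^ s ∂nakagamiMeasure m θ =
      (m / θ) ^ (-(s / 2)) * (Real.Gamma (m + s / 2) / Real.Gamma m) := by
  have h1 : ∫ x in Set.Ioi (0 : ℝ), x ^ (2 * m - 1) * Real.exp (-(m / θ) * x ^ 2) * x ^ s =
      ∫ x in Set.Ioi (0 : ℝ), x ^ (2 * m - 1 + s) * Real.exp (-(m / θ) * x ^ (2 : ℝ)) :=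
    setIntegral_congr_fun measurableSet_Ioi fun x hx => by
      have hx' : 0 < x := hx
      simp only [Real.rpow_add hx', Real.rpow_two]
      ring
  have hb : 0 < m / θ := by positivity
  rw [integral_nakagamiMeasure hm hθ, h1,
    integral_rpow_mul_exp_neg_mul_rpow two_pos (by linarith) hb,
    show (2 * m - 1 + s + 1) / 2 = m + s / 2 by ring,
    show -(2 * m - 1 + s + 1) / 2 = -m + -(s / 2) by ring, Real.rpow_add hb, Real.rpow_neg hb.le]
  have := (Real.rpow_pos_of_pos hb m).ne'
  field_simp

theorem integral_sq_nakagamiMeasure : ∫ x, x ^ 2 ∂nakagamiMeasure m θ = θ := by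
  have h := integral_rpow_nakagamiMeasure hm hθ (s := 2) (by positivity)
  simp only [Real.rpow_two] at h
  rw [h, show (2 / 2 : ℝ) = 1 by norm_num, Real.Gamma_add_one hm.ne', Real.rpow_neg_one]
  have := (Real.Gamma_pos_of_pos hm).ne'
  field_simp

end Density

theorem rpow_neg_two_eq_inv_sq (x : ℝ) : x ^ (-2 : ℝ) = (x ^ 2)⁻¹ := by
  rw [show (-2 : ℝ) = ((-2 : ℤ) : ℝ) by norm_num, Real.rpow_intCast, _root_.zpow_neg]
  rfl

/-- Near zero the integrand behaves like `x ^ (2 * m - 3)`, which is where `m > 1` is needed. -/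
theorem integrable_inv_sq_nakagamiMeasure {m θ : ℝ} (hm : 1 < m) (hθ : 0 < θ) :
    Integrable (fun x => (x ^ 2)⁻¹) (nakagamiMeasure m θ) := by
  have h := integrable_rpow_nakagamiMeasure (by linarith : 0 < m) hθ (s := -2) (by linarith)
  simpa only [rpow_neg_two_eq_inv_sq] using h

theorem integral_inv_sq_nakagamiMeasure {m θ : ℝ} (hm : 1 < m) (hθ : 0 < θ) :
    ∫ x, (x ^ 2)⁻¹ ∂nakagamiMeasure m θ = m / θ / (m - 1) := by
  have hm' : 0 < m - 1 := by linarith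
  have h := integral_rpow_nakagamiMeasure (by linarith : 0 < m) hθ (s := -2) (by linarith)
  simp only [rpow_neg_two_eq_inv_sq] at h
  have hG : Real.Gamma m = (m - 1) * Real.Gamma (m - 1) := by
    rw [← Real.Gamma_add_one hm'.ne', sub_add_cancel]
  rw [h, show (-(-2 / 2) : ℝ) = 1 by norm_num, show m + -2 / 2 = m - 1 by ring, Real.rpow_one, hG]
  have := (Real.Gamma_pos_of_pos hm').ne'
  field_simp

/-- An exponential integral bound, `e^a E₁(a) ≤ log (1 + 1 / a)`. -/
theorem integral_inv_add_sq_nakagamiMeasure_le {a : ℝ} (ha : 0 < a) :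
    ∫ x, (a + x ^ 2)⁻¹ ∂nakagamiMeasure 1 1 ≤ Real.log (1 + 1 / a) := by
  -- With `y = a + x²`, `φ = log (1 + 1 / y)`. The function `g'` is the derivative of `-exp (-x²)
  -- φ`, and it dominates the integrand `2 x exp (-x²) / y` because `φ ≥ 1 / (y + 1)`. Its integral
  -- is `φ 0`.
  set φ : ℝ → ℝ := fun x => Real.log (a + x ^ 2 + 1) - Real.log (a + x ^ 2) with hφ
  set g' : ℝ → ℝ := fun x => 2 * x * Real.exp (-x ^ 2) *
    (φ x + (a + x ^ 2)⁻¹ - (a + x ^ 2 + 1)⁻¹) with hg'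
  have hφ_ge : ∀ x, (a + x ^ 2 + 1)⁻¹ ≤ φ x := fun x => by
    have hy : 0 < a + x ^ 2 := by positivity
    have h1 : φ x = Real.log ((a + x ^ 2 + 1) / (a + x ^ 2)) :=
      (Real.log_div (by positivity) hy.ne').symm
    have h2 := Real.one_sub_inv_le_log_of_pos
      (show 0 < (a + x ^ 2 + 1) / (a + x ^ 2) by positivity)
    rw [h1]
    refine le_trans (le_of_eq ?_) h2
    field_simp
    ring
  -- This crude bound serves only to make the primitive vanish at infinity.
  have hφ_le : ∀ x, φ x ≤ a⁻¹ := fun x => by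
    have hy : 0 < a + x ^ 2 := by positivity
    have h1 : φ x = Real.log ((a + x ^ 2 + 1) / (a + x ^ 2)) :=
      (Real.log_div (by positivity) hy.ne').symm
    have h2 := Real.log_le_sub_one_of_pos
      (show 0 < (a + x ^ 2 + 1) / (a + x ^ 2) by positivity)
    rw [h1]
    refine h2.trans ?_
    have : (a + x ^ 2 + 1) / (a + x ^ 2) - 1 = (a + x ^ 2)⁻¹ := by field_simp; ring
    rw [this]
    exact inv_anti₀ ha (by nlinarith [sq_nonneg x])
  have hderiv : ∀ x ∈ Set.Ici (0 : ℝ), HasDerivAt (fun x => -(Real.exp (-x ^ 2) * φ x)) (g' x) x :=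
    fun x _ => by
      have hy : a + x ^ 2 ≠ 0 := by positivity
      have hy1 : a + x ^ 2 + 1 ≠ 0 := by positivity
      have hs : HasDerivAt (fun x : ℝ => x ^ 2) (2 * x) x := by simpa using hasDerivAt_pow 2 x
      have h1 := (((hs.const_add a).add_const 1).log hy1).sub ((hs.const_add a).log hy)
      refine (hs.neg.exp.mul h1).neg.congr_deriv ?_
      simp only [hg', hφ, Pi.sub_apply, Pi.neg_apply]
      field_simp
      ring
  have hpos : ∀ x ∈ Set.Ioi (0 : ℝ), 0 ≤ g' x := fun x hx => by
    have hx' : 0 < x := hx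
    have : 0 ≤ φ x + (a + x ^ 2)⁻¹ - (a + x ^ 2 + 1)⁻¹ := by
      have := hφ_ge x
      have : 0 ≤ (a + x ^ 2)⁻¹ := by positivity
      linarith
    positivity
  have hlim : Filter.Tendsto (fun x => -(Real.exp (-x ^ 2) * φ x)) Filter.atTop (nhds 0) := by
    have hexp : Filter.Tendsto (fun x : ℝ => Real.exp (-x ^ 2)) Filter.atTop (nhds 0) :=
      Real.tendsto_exp_neg_atTop_nhds_zero.comp (Filter.tendsto_pow_atTop two_ne_zero)
    have h1 : Filter.Tendsto (fun x => Real.exp (-x ^ 2) * φ x) Filter.atTop (nhds 0) := by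
      refine squeeze_zero (fun x => ?_) (fun x => ?_) (by simpa using hexp.mul_const a⁻¹)
      · have h0 : 0 ≤ (a + x ^ 2 + 1)⁻¹ := by positivity
        exact mul_nonneg (Real.exp_pos _).le (h0.trans (hφ_ge x))
      · exact mul_le_mul_of_nonneg_left (hφ_le x) (Real.exp_pos _).le
    simpa using h1.neg
  have hint := integrableOn_Ioi_deriv_of_nonneg' hderiv hpos hlim
  have hval := integral_Ioi_of_hasDerivAt_of_nonneg' hderiv hpos hlim
  have hle : ∫ x in Set.Ioi (0 : ℝ), 2 * x * Real.exp (-x ^ 2) * (a + x ^ 2)⁻¹ ≤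
      ∫ x in Set.Ioi (0 : ℝ), g' x := by
    refine integral_mono_of_nonneg ?_ hint ?_
    · filter_upwards [ae_restrict_mem measurableSet_Ioi] with x hx
      have hx' : 0 < x := hx
      simp only [Pi.zero_apply]
      positivity
    · filter_upwards [ae_restrict_mem measurableSet_Ioi] with x hx
      have hx' : 0 < x := hx
      refine mul_le_mul_of_nonneg_left ?_ (by positivity)
      linarith [hφ_ge x]
  have hφ0 : φ 0 = Real.log (1 + 1 / a) := by
    have h1 : φ 0 = Real.log ((a + 1) / a) := by
      rw [Real.log_div (by positivity) ha.ne']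
      simp [hφ]
    rw [h1]
    congr 1
    field_simp
  have hlhs : ∫ x, (a + x ^ 2)⁻¹ ∂nakagamiMeasure 1 1 =
      ∫ x in Set.Ioi (0 : ℝ), 2 * x * Real.exp (-x ^ 2) * (a + x ^ 2)⁻¹ := by
    rw [integral_nakagamiMeasure one_pos one_pos, ← integral_const_mul]
    refine integral_congr_ae (ae_of_all _ fun x => ?_)
    simp only
    rw [show (2 * 1 - 1 : ℝ) = 1 by norm_num, Real.rpow_one, Real.Gamma_one, div_one,
      Real.rpow_one]
    ring_nf
  rw [hlhs]
  refine hle.trans (le_of_eq ?_)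
  rw [hval]
  simp [hφ0]

end Nakagami

/-! ### Scalar channels -/

section ScalarFading

variable {Ω : Type*} [MeasurableSpace Ω] {μ : Measure Ω}
  {H : Ω → Matrix (Fin 1) (Fin 1) ℂ} {Px Ps Pw : ℝ}

theorem snr_one (Px Pw : ℝ) : snr 1 Px Pw = Px / Pw := by simp [snr]

theorem gramMatrix_fin_one (H : Matrix (Fin 1) (Fin 1) ℂ) :
    gramMatrix H = ((‖H 0 0‖ ^ 2 : ℝ) : ℂ) • (1 : Matrix (Fin 1) (Fin 1) ℂ) := by
  ext i j
  fin_cases i; fin_cases j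
  simp [gramMatrix, Matrix.mul_apply, Complex.conj_mul']

theorem inv_smul_one_fin_one (c : ℝ) :
    ((c : ℂ) • (1 : Matrix (Fin 1) (Fin 1) ℂ))⁻¹ = ((c⁻¹ : ℝ) : ℂ) • 1 := by
  ext i j
  fin_cases i; fin_cases j
  simp

theorem logDet_smul_one_fin_one (c : ℝ) :
    logDet ((c : ℂ) • (1 : Matrix (Fin 1) (Fin 1) ℂ)) = Real.logb 2 c := by
  simp [logDet]

theorem finiteMatrixExpectation_smul_one_fin_one {f : Ω → ℝ} (hf : Integrable f μ) :
    FiniteMatrixExpectation μ fun ω => ((f ω : ℝ) : ℂ) • (1 : Matrix (Fin 1) (Fin 1) ℂ) :=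
  fun i j => by
    fin_cases i; fin_cases j
    simpa using hf.ofReal (𝕜 := ℂ)

theorem matrixExpectation_smul_one_fin_one (f : Ω → ℝ) :
    (matrixExpectation μ fun ω => ((f ω : ℝ) : ℂ) • (1 : Matrix (Fin 1) (Fin 1) ℂ)) =
      ((∫ ω, f ω ∂μ : ℝ) : ℂ) • 1 := by
  ext i j
  fin_cases i; fin_cases j
  simp only [matrixExpectation, Matrix.of_apply, Matrix.smul_apply, Fin.zero_eta,
    Matrix.one_apply_eq, smul_eq_mul, mul_one]
  exact integral_complex_ofReal

theorem measurable_entries_fin_one (hH : Measurable fun ω => H ω 0 0) :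
    ∀ i j, Measurable fun ω => H ω i j := fun i j => by
  fin_cases i; fin_cases j
  exact hH

theorem finiteMatrixExpectation_gramMatrix_fin_one (h2 : ∫ ω, ‖H ω 0 0‖ ^ 2 ∂μ = 1) :
    FiniteMatrixExpectation μ fun ω => gramMatrix (H ω) := by
  simp_rw [gramMatrix_fin_one]
  -- The Bochner integral of a non-integrable function is `0`, so a second moment equal to `1`
  -- already entails integrability.
  refine finiteMatrixExpectation_smul_one_fin_one (Integrable.of_integral_ne_zero ?_)
  rw [h2]
  exact one_ne_zero

theorem matrixExpectation_gramMatrix_fin_one (h2 : ∫ ω, ‖H ω 0 0‖ ^ 2 ∂μ = 1) :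
    (matrixExpectation μ fun ω => gramMatrix (H ω)) = 1 := by
  simp_rw [gramMatrix_fin_one]
  rw [matrixExpectation_smul_one_fin_one, h2]
  simp

theorem logDet_one_add_smul_one_fin_one (ρ : ℝ) :
    logDet (1 + (ρ : ℂ) • (1 : Matrix (Fin 1) (Fin 1) ℂ)) = Real.logb 2 (1 + ρ) := by
  rw [← logDet_smul_one_fin_one, Complex.ofReal_add, add_smul, Complex.ofReal_one, one_smul]

/-- Below unit signal-to-noise ratio, even the full capacity is less than one bit. -/
theorem capacityGap_lt_one_of_snr_lt_one [IsProbabilityMeasure μ] (hPx : 0 < Px)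
    (hPw : 0 < Pw) (hρ : snr 1 Px Pw < 1) (hH : Measurable fun ω => H ω 0 0)
    (h2 : ∫ ω, ‖H ω 0 0‖ ^ 2 ∂μ = 1) :
    capacityGap μ H Px Ps Pw < 1 := by
  have hρ0 := snr_pos le_rfl hPx hPw
  have h := capacityGap_le_logDet (Ps := Ps) (measurable_entries_fin_one hH)
    (finiteMatrixExpectation_gramMatrix_fin_one h2) hρ0.le
  rw [matrixExpectation_gramMatrix_fin_one h2, logDet_one_add_smul_one_fin_one] at h
  refine h.trans_lt ?_
  rw [Real.logb_lt_iff_lt_rpow one_lt_two (by linarith)]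
  norm_num
  linarith

theorem capacityGap_lt_of_nakagami [IsProbabilityMeasure μ] {m θ : ℝ} (hPx : 0 < Px)
    (hPs : 0 < Ps) (hPw : 0 < Pw) (hm : 1 < m) (hθ : 0 < θ) (hH : Measurable fun ω => H ω 0 0)
    (hlaw : μ.map (fun ω => ‖H ω 0 0‖) = nakagamiMeasure m θ)
    (h2 : ∫ ω, ‖H ω 0 0‖ ^ 2 ∂μ = 1) :
    capacityGap μ H Px Ps Pw < 1 + Real.logb 2 (1 + 1 / (m - 1)) := by
  have hm' : 0 < m - 1 := by linarith
  rcases lt_or_ge (snr 1 Px Pw) 1 with hρ | hρ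
  · have h := capacityGap_lt_one_of_snr_lt_one (Ps := Ps) hPx hPw hρ hH h2
    have h0 : 0 ≤ Real.logb 2 (1 + 1 / (m - 1)) :=
      Real.logb_nonneg one_lt_two (by linarith [one_div_pos.mpr hm'])
    linarith
  · have hnorm : AEMeasurable (fun ω => ‖H ω 0 0‖) μ := hH.norm.aemeasurable
    -- The spread is the second moment of the Nakagami law.
    have hθ1 : θ = 1 := by
      rw [← integral_sq_nakagamiMeasure (by linarith : 0 < m) hθ, ← hlaw,
        integral_map hnorm (by fun_prop), h2]
    have hpos : ∀ᵐ ω ∂μ, 0 < ‖H ω 0 0‖ :=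
      ae_of_ae_map hnorm (hlaw ▸ ae_nakagamiMeasure_pos m θ)
    have hu : ∀ᵐ ω ∂μ, IsUnit (gramMatrix (H ω)) := hpos.mono fun ω hω => by
      rw [Matrix.isUnit_iff_isUnit_det, gramMatrix_fin_one]
      simpa using hω
    have hint : Integrable (fun ω => (‖H ω 0 0‖ ^ 2)⁻¹) μ :=
      (integrable_map_measure (g := fun x : ℝ => (x ^ 2)⁻¹)
        (by fun_prop : Measurable _).aestronglyMeasurable hnorm).mp
        (hlaw.symm ▸ integrable_inv_sq_nakagamiMeasure hm hθ)
    have hval : ∫ ω, (‖H ω 0 0‖ ^ 2)⁻¹ ∂μ = m / (m - 1) := by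
      have h := integral_inv_sq_nakagamiMeasure hm hθ
      rw [← hlaw, integral_map hnorm (by fun_prop : Measurable _).aestronglyMeasurable, hθ1,
        div_one] at h
      exact h
    have hinv : ∀ ω, (gramMatrix (H ω))⁻¹ =
        (((‖H ω 0 0‖ ^ 2)⁻¹ : ℝ) : ℂ) • (1 : Matrix (Fin 1) (Fin 1) ℂ) := fun ω => by
      rw [gramMatrix_fin_one, inv_smul_one_fin_one]
    have h := capacityGap_lt_of_isUnit_gramMatrix le_rfl hPx hPs hρ (measurable_entries_fin_one hH)
      (finiteMatrixExpectation_gramMatrix_fin_one h2) hu (by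
        simp_rw [hinv]
        exact finiteMatrixExpectation_smul_one_fin_one hint)
    refine h.trans_eq ?_
    simp_rw [hinv]
    rw [matrixExpectation_gramMatrix_fin_one h2, matrixExpectation_smul_one_fin_one, hval,
      logDet_mul (Matrix.PosDef.one.add Matrix.PosDef.one)
        (Matrix.PosDef.one.smul (by exact_mod_cast (by positivity : 0 < m / (m - 1)))),
      logDet_smul_one_fin_one]
    -- The factor `1 + E[|h|²] = 2` is the one bit in the bound.
    have h11 := logDet_one_add_smul_one_fin_one 1
    rw [Complex.ofReal_one, one_smul, one_add_one_eq_two (R := ℝ), Real.logb_self_eq_one one_lt_two]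
      at h11
    rw [h11]
    congr 2
    field_simp
    ring

theorem capacityGap_lt_of_rayleigh [IsProbabilityMeasure μ] {σ : ℝ} (hPx : 0 < Px)
    (hPs : 0 < Ps) (hPw : 0 < Pw) (hσ : 0 < σ) (hH : Measurable fun ω => H ω 0 0)
    (hlaw : μ.map (fun ω => ‖H ω 0 0‖) = rayleighMeasure σ)
    (h2 : ∫ ω, ‖H ω 0 0‖ ^ 2 ∂μ = 1) :
    capacityGap μ H Px Ps Pw <
      1.48 + Real.logb 2 (Real.logb 2 (1 + max (max (Px / Pw) (Ps / Pw)) 1)) := by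
  set κ := max (max (Px / Pw) (Ps / Pw)) 1 with hκ
  have hκ1 : 1 ≤ κ := le_max_right _ _
  have hln2 : 0 < Real.log 2 := Real.log_pos one_lt_two
  have hlogκ : 1 ≤ Real.logb 2 (1 + κ) := by
    rw [Real.le_logb_iff_rpow_le one_lt_two (by linarith)]
    norm_num
    linarith
  rcases lt_or_ge (snr 1 Px Pw) 1 with hρ | hρ
  · have h := capacityGap_lt_one_of_snr_lt_one (Ps := Ps) hPx hPw hρ hH h2
    have h0 : 0 ≤ Real.logb 2 (Real.logb 2 (1 + κ)) := Real.logb_nonneg one_lt_two hlogκ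
    norm_num
    linarith
  · have hnorm : AEMeasurable (fun ω => ‖H ω 0 0‖) μ := hH.norm.aemeasurable
    have hG := finiteMatrixExpectation_gramMatrix_fin_one h2
    have hρ0 : 0 < snr 1 Px Pw := one_pos.trans_le hρ
    rw [rayleighMeasure_eq_nakagamiMeasure hσ] at hlaw
    have hθ1 : 2 * σ ^ 2 = 1 := by
      rw [← integral_sq_nakagamiMeasure one_pos (by positivity : 0 < 2 * σ ^ 2), ← hlaw,
        integral_map hnorm (by fun_prop), h2]
    rw [hθ1] at hlaw
    -- Factoring `Px / Pw` out of the scalar lattice matrix leaves `a + |h|²`.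
    set a := Pw / (Px + Ps) with ha
    have ha0 : 0 < a := by positivity
    have hmat : ∀ ω, (latticeMatrix Px Ps Pw (H ω))⁻¹ =
        ((((Px / Pw)⁻¹ * (a + ‖H ω 0 0‖ ^ 2)⁻¹ : ℝ)) : ℂ) • (1 : Matrix (Fin 1) (Fin 1) ℂ) :=
      fun ω => by
        have h1 : latticeMatrix Px Ps Pw (H ω) =
            ((Px / Pw * (a + ‖H ω 0 0‖ ^ 2) : ℝ) : ℂ) • (1 : Matrix (Fin 1) (Fin 1) ℂ) := by
          rw [latticeMatrix, gramMatrix_fin_one, snr_one, smul_smul, ← add_smul,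
            ← Complex.ofReal_mul, ← Complex.ofReal_add]
          congr 2
          rw [ha]
          push_cast
          field_simp
        rw [h1, inv_smul_one_fin_one, mul_inv]
    set J := ∫ ω, (a + ‖H ω 0 0‖ ^ 2)⁻¹ ∂μ with hJ
    have hLEM : latticeErrorMatrix μ H Px Ps Pw =
        ((((Px / Pw)⁻¹ * J : ℝ)) : ℂ) • (1 : Matrix (Fin 1) (Fin 1) ℂ) := by
      rw [latticeErrorMatrix]
      simp_rw [hmat]
      rw [matrixExpectation_smul_one_fin_one, integral_const_mul]
    have hJpos : 0 < (Px / Pw)⁻¹ * J := by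
      have h := (ratesWellDefined hPx hPs hρ0.le (measurable_entries_fin_one hH) hG).2.2.det_re_pos
      rw [hLEM] at h
      simpa using h
    have hJle : J ≤ Real.log (1 + 1 / a) := by
      have h := integral_inv_add_sq_nakagamiMeasure_le ha0
      rwa [← hlaw, integral_map hnorm (by fun_prop : Measurable _).aestronglyMeasurable] at h
    -- `1 / a = Px / Pw + Ps / Pw ≤ 2 κ`, and `1 + 2 κ < (1 + κ)²`.
    have hJlt : J < 2 * Real.log (1 + κ) := by
      refine hJle.trans_lt ?_
      have h1 : 1 / a ≤ 2 * κ := by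
        rw [ha, one_div_div, add_div]
        have h3 : Px / Pw ≤ κ := (le_max_left _ _).trans (le_max_left _ _)
        have h4 : Ps / Pw ≤ κ := (le_max_right _ _).trans (le_max_left _ _)
        linarith
      have h5 : 2 * Real.log (1 + κ) = Real.log ((1 + κ) ^ 2) := by
        rw [Real.log_pow]; norm_num
      rw [h5]
      refine Real.log_lt_log (by positivity) ?_
      nlinarith
    have h := capacityGap_le_add_logDet (Px := Px) (Ps := Ps) (Pw := Pw)
      (measurable_entries_fin_one hH) hG hρ0.le
    rw [matrixExpectation_gramMatrix_fin_one h2, logDet_one_add_smul_one_fin_one, hLEM,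
      logDet_smul_one_fin_one, ← Real.logb_mul (by positivity) hJpos.ne'] at h
    rw [snr_one] at h hρ hρ0
    -- Source of `1.48`: one factor `2` from `(1 + ρ) / ρ`, one from `hJlt`, and `log 2` from the
    -- change of base. As `1.48 = 37 / 25`, it suffices to compare 25th powers.
    have h48 : Real.logb 2 (4 * Real.log 2) ≤ 1.48 := by
      rw [Real.logb_le_iff_le_rpow one_lt_two (by positivity)]
      refine le_of_pow_le_pow_left₀ (n := 25) (by norm_num) (by positivity) ?_
      rw [← Real.rpow_natCast, ← Real.rpow_natCast, ← Real.rpow_mul two_pos.le]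
      have h25 : (1.48 * ((25 : ℕ) : ℝ)) = ((37 : ℕ) : ℝ) := by norm_num
      rw [h25, Real.rpow_natCast, Real.rpow_natCast]
      calc (4 * Real.log 2) ^ 25 ≤ (4 * 0.6932) ^ 25 := by
            refine pow_le_pow_left₀ (by positivity) ?_ _
            linarith [Real.log_two_lt_d9]
        _ ≤ 2 ^ 37 := by norm_num
    refine h.trans_lt ?_
    have hlt : (1 + Px / Pw) * ((Px / Pw)⁻¹ * J) < 4 * Real.log 2 * Real.logb 2 (1 + κ) := by
      have h6 : 4 * Real.log 2 * Real.logb 2 (1 + κ) = 2 * (2 * Real.log (1 + κ)) := by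
        rw [Real.logb]; field_simp; ring
      have hJ0 : 0 < J := pos_of_mul_pos_right hJpos (by positivity)
      have h7 : (1 + Px / Pw) * (Px / Pw)⁻¹ ≤ 2 := by
        rw [← div_eq_mul_inv, div_le_iff₀ hρ0]; linarith
      rw [h6, ← mul_assoc]
      exact (mul_le_mul_of_nonneg_right h7 hJ0.le).trans_lt (by linarith)
    calc _ < Real.logb 2 (4 * Real.log 2 * Real.logb 2 (1 + κ)) :=
          Real.logb_lt_logb one_lt_two (by positivity) hlt
      _ = Real.logb 2 (4 * Real.log 2) + Real.logb 2 (Real.logb 2 (1 + κ)) :=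
          Real.logb_mul (by positivity) (by linarith)
      _ ≤ _ := by linarith

end ScalarFading

/-! ### The four fading cases combined -/

theorem corollary2 {Ω : Type*} [MeasurableSpace Ω] (μ : Measure Ω) [IsProbabilityMeasure μ]
    (Px Ps Pw : ℝ) (hPx : 0 < Px) (hPs : 0 < Ps) (hPw : 0 < Pw) :
    -- general fading, `N ≥ M`, `ρ ≥ 1`
    (∀ (N M : ℕ) (H : Ω → Matrix (Fin N) (Fin M) ℂ),
      1 ≤ M → M ≤ N → 1 ≤ snr M Px Pw →
      (∀ i j, Measurable fun ω => H ω i j) →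
      FiniteMatrixExpectation μ (fun ω => gramMatrix (H ω)) →
      (∀ᵐ ω ∂μ, IsUnit (gramMatrix (H ω))) →
      FiniteMatrixExpectation μ (fun ω => (gramMatrix (H ω))⁻¹) →
      RatesWellDefined μ H Px Ps Pw ∧
      capacityGap μ H Px Ps Pw <
        logDet ((1 + matrixExpectation μ (fun ω => gramMatrix (H ω))) *
          matrixExpectation μ (fun ω => (gramMatrix (H ω))⁻¹))) ∧
    -- i.i.d. Rayleigh fading, `N > M`, `ρ ≥ 1`
    (∀ (N M : ℕ) (H : Ω → Matrix (Fin N) (Fin M) ℂ),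
      1 ≤ M → M < N → 1 ≤ snr M Px Pw →
      (∀ i j, Measurable fun ω => H ω i j) →
      IsIIDRayleigh μ H →
      RatesWellDefined μ H Px Ps Pw ∧
      capacityGap μ H Px Ps Pw <
        M * Real.logb 2 (1 + ((M : ℝ) + 1) / ((N : ℝ) - (M : ℝ)))) ∧
    -- scalar Nakagami fading with shape `m > 1` and `E|h|² = 1`
    (∀ (m θ : ℝ) (H : Ω → Matrix (Fin 1) (Fin 1) ℂ),
      1 < m → 0 < θ →
      (Measurable fun ω => H ω 0 0) →
      μ.map (fun ω => ‖H ω 0 0‖) = nakagamiMeasure m θ →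
      ∫ ω, ‖H ω 0 0‖ ^ 2 ∂μ = 1 →
      RatesWellDefined μ H Px Ps Pw ∧
      capacityGap μ H Px Ps Pw < 1 + Real.logb 2 (1 + 1 / (m - 1))) ∧
    -- scalar Rayleigh fading with `E|h|² = 1`
    (∀ (σ : ℝ) (H : Ω → Matrix (Fin 1) (Fin 1) ℂ),
      0 < σ →
      (Measurable fun ω => H ω 0 0) →
      μ.map (fun ω => ‖H ω 0 0‖) = rayleighMeasure σ →
      ∫ ω, ‖H ω 0 0‖ ^ 2 ∂μ = 1 →
      RatesWellDefined μ H Px Ps Pw ∧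
      capacityGap μ H Px Ps Pw <
        1.48 + Real.logb 2 (Real.logb 2 (1 + max (max (Px / Pw) (Ps / Pw)) 1))) := by
  refine ⟨fun N M H hM _ hρ hH hG hu hinv => ⟨ratesWellDefined hPx hPs (zero_le_one.trans hρ) hH hG,
      capacityGap_lt_of_isUnit_gramMatrix hM hPx hPs hρ hH hG hu hinv⟩,
    fun N M H hM hNM hρ hH hiid => capacityGap_lt_of_isIIDRayleigh hM hNM hPx hPs hρ hH hiid,
    fun m θ H hm hθ hH hlaw h2 => ⟨?_, capacityGap_lt_of_nakagami hPx hPs hPw hm hθ hH hlaw h2⟩,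
    fun σ H hσ hH hlaw h2 => ⟨?_, capacityGap_lt_of_rayleigh hPx hPs hPw hσ hH hlaw h2⟩⟩
  all_goals
    exact ratesWellDefined hPx hPs (snr_pos le_rfl hPx hPw).le
      (measurable_entries_fin_one hH) (finiteMatrixExpectation_gramMatrix_fin_one h2)
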